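/- Let $n\ge 5$ be an odd integer and let $C_n$ be the $n$-cycle on the vertices $1,\dots,n$. A behavior is a vector $p\in[0,1]^n$ with $p_i+p_j\le 1$ whenever $i\sim j$ in $C_n$. Let $\mathcal P_{nc}(C_n)$ be the convex hull of the $\{0,1\}$-valued behaviors, and let $\mathcal P_q(C_n)$ be the set of quantum behaviors, i.e. the behaviors $p$ for which there are a density operator $\rho$ and orthogonal projectors $\Pi_1,\dots,\Pi_n$ on a complex Hilbert space with $p_i=\mathrm{tr}(\rho\Pi_i)$ for all $i$ and $\mathrm{tr}(\Pi_i\Pi_j)=0$ whenever $i\sim j$. Put $B_q=\sup\{\sum_{i=1}^n p_i: p\in\mathcal P_q(C_n)\}$. A realization on a complex Hilbert space $\mathcal H$ is a family $\{|u_i\rangle\langle u_i|\}_{i=0}^n$ with unit vectors $u_0,\dots,u_n\in\mathcal H$ such that $\langle u_i|u_j\rangle=0$ whenever $i\sim j$, $1\le i,j\le n$; its value is $\sum_{i=1}^n|\langle u_0|u_i\rangle|^2$. Let $\theta\in\mathbb R$ satisfy $\cos^2\theta=\frac{\cos(\pi/n)}{1+\cos(\pi/n)}$, let $\phi_j=\frac{j\pi(n-1)}{n}$,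 and in $\mathbb C^3$ let $$u_0=(1,0,0)^T,\qquad u_j=(\cos\theta,\ \sin\theta\sin\phi_j,\ \sin\theta\cos\phi_j)^T\quad(1\le j\le n).$$ Then the $\mathrm{KCBS}_n$ inequality $\sum_{i=1}^n p_i\le\frac{n-1}{2}$ is a noncontextuality inequality for $C_n$, with $\max\{\sum_{i=1}^n p_i:p\in\mathcal P_{nc}(C_n)\}=\frac{n-1}{2}$, and it is an $(\epsilon,\tfrac12)$-robust self-test for the realization $\{|u_i\rangle\langle u_i|\}_{i=0}^n$. That is: 1. $\{|u_i\rangle\langle u_i|\}_{i=0}^n$ is a realization and its value is $B_q$, which is the maximum of $\sum_{i=1}^n p_i$ over $\mathcal P_q(C_n)$. 2. For every realization $\{|u_i'\rangle\langle u_i'|\}_{i=0}^n$ on a complex Hilbert space $\mathcal H'$ with value $B_q$ there is a linear isometry $V:\mathbb C^3\to\mathcal H'$ with $V|u_i\rangle\langle u_i|V^\dagger=|u_i'\rangle\langle u_i'|$ for all $0\le i\le n$. 3. There is a constant $C$, independent of $\epsilon$, of $\mathcal H'$ and of the realization, such that for every $\epsilon>0$ and every realization $\{|u_i'\rangle\langle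 u_i'|\}_{i=0}^n$ on a complex Hilbert space $\mathcal H'$ with $\sum_{i=1}^n|\langle u_0'|u_i'\rangle|^2\ge B_q-\epsilon$ there is a linear isometry $V:\mathbb C^3\to\mathcal H'$ with $\big\|V|u_i\rangle\langle u_i|V^\dagger-|u_i'\rangle\langle u_i'|\big\|\le C\,\epsilon^{1/2}$ (operator norm) for all $0\le i\le n$. -/

import Mathlib

universe u v

namespace Contextuality

/-! Exclusivity graphs have vertex set `Fin n`; vertex `i` stands for the event usually
numbered `i + 1`, so that in a family indexed by `Fin (n + 1)` the entry `0` belongs to the state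
and the entry `i.succ` to the event of vertex `i`. -/

section Behaviors

variable {n : ℕ}

/-- A behavior of the exclusivity graph `G`. -/
def IsBehavior (G : SimpleGraph (Fin n)) (p : Fin n → ℝ) : Prop :=
  (∀ i, 0 ≤ p i ∧ p i ≤ 1) ∧ ∀ i j, G.Adj i j → p i + p j ≤ 1

/-- A deterministic noncontextual behavior: a behavior with values in `{0, 1}`. -/
def IsDeterministic (G : SimpleGraph (Fin n)) (p : Fin n → ℝ) : Prop :=
  (∀ i, p i = 0 ∨ p i = 1) ∧ ∀ i j, G.Adj i j → p i + p j ≤ 1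

/-- The polytope of noncontextual behaviors. -/
def noncontextualBehaviors (G : SimpleGraph (Fin n)) : Set (Fin n → ℝ) :=
  convexHull ℝ {p | IsDeterministic G p}

/-- The value `∑ i, w i * p i` of a behavior. -/
def value (w p : Fin n → ℝ) : ℝ := ∑ i, w i * p i

/-- `∑ i, w i * p i ≤ B` is a noncontextuality inequality of `G` with nonnegative weights `w`, and
`B` is the noncontextual bound, i.e. the maximum over the noncontextual behaviors. -/
def IsNoncontextualityInequality (G : SimpleGraph (Fin n)) (w : Fin n → ℝ) (B : ℝ) : Prop :=
  (∀ i, 0 ≤ w i) ∧ IsGreatest (value w '' noncontextualBehaviors G) B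

end Behaviors

section Quantum

/-- The operator `A` on a Hilbert space has trace `t`: in every Hilbert basis the diagonal entries
of `A` sum (unconditionally) to `t`. -/
def HasTrace {H : Type u} [NormedAddCommGroup H] [InnerProductSpace ℂ H]
    (A : H →L[ℂ] H) (t : ℂ) : Prop :=
  ∀ (ι : Type u) (b : HilbertBasis ι ℂ H), HasSum (fun k => inner ℂ (b k) (A (b k))) t

/-- A quantum realization of `p`: a state (density operator) `ρ` and projectors `P i` on a Hilbert
space with `p i = tr (ρ P i)`, and `tr (P i P j) = 0` for exclusive events. -/
structure IsQuantumRealization {n : ℕ} (G : SimpleGraph (Fin n)) (p : Fin n → ℝ)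
    {H : Type u} [NormedAddCommGroup H] [InnerProductSpace ℂ H] [CompleteSpace H]
    (ρ : H →L[ℂ] H) (P : Fin n → H →L[ℂ] H) : Prop where
  state_pos : ρ.IsPositive
  state_trace : HasTrace ρ 1
  proj : ∀ i, IsStarProjection (P i)
  prob : ∀ i, HasTrace (ρ ∘L P i) (p i : ℂ)
  excl : ∀ i j, G.Adj i j → HasTrace (P i ∘L P j) 0

/-- The set of quantum behaviors. -/
def quantumBehaviors {n : ℕ} (G : SimpleGraph (Fin n)) : Set (Fin n → ℝ) :=
  {p | IsBehavior G p ∧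
    ∃ (H : Type u) (_ : NormedAddCommGroup H) (_ : InnerProductSpace ℂ H) (_ : CompleteSpace H)
      (ρ : H →L[ℂ] H) (P : Fin n → H →L[ℂ] H), IsQuantumRealization G p ρ P}

/-- The quantum supremum of the inequality with weights `w`. -/
noncomputable def quantumSupremum {n : ℕ} (G : SimpleGraph (Fin n)) (w : Fin n → ℝ) : ℝ :=
  sSup (value w '' quantumBehaviors.{u} G)

/-- A realization `{|u i⟩⟨u i|}` for `0 ≤ i ≤ n` by unit vectors: the pure state `u 0` and rank-one
projectors onto the `u i.succ`, orthogonal for exclusive events. -/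
structure IsRealization {n : ℕ} (G : SimpleGraph (Fin n))
    {H : Type v} [NormedAddCommGroup H] [InnerProductSpace ℂ H] (x : Fin (n + 1) → H) : Prop where
  norm_eq_one : ∀ i, ‖x i‖ = 1
  excl : ∀ i j, G.Adj i j → inner ℂ (x i.succ) (x j.succ) = 0

/-- The behavior `p i = |⟨u 0 | u i⟩|²` of a realization. -/
noncomputable def behavior {n : ℕ} {H : Type v} [NormedAddCommGroup H] [InnerProductSpace ℂ H]
    (x : Fin (n + 1) → H) : Fin n → ℝ :=
  fun i => ‖inner ℂ (x 0) (x i.succ)‖ ^ 2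

/-- The projector `|x⟩⟨x|`. -/
noncomputable def proj {H : Type v} [NormedAddCommGroup H] [InnerProductSpace ℂ H] (x : H) :
    H →L[ℂ] H :=
  InnerProductSpace.rankOne ℂ x x

/-- The operator `V A V†` on `H` for an isometry `V : K → H` and an operator `A` on `K`. -/
noncomputable def conj {K : Type v} {H : Type u} [NormedAddCommGroup K] [InnerProductSpace ℂ K]
    [CompleteSpace K] [NormedAddCommGroup H] [InnerProductSpace ℂ H] [CompleteSpace H]
    (V : K →ₗᵢ[ℂ] H) (A : K →L[ℂ] K) : H →L[ℂ] H :=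
  V.toContinuousLinearMap ∘L A ∘L (ContinuousLinearMap.adjoint V.toContinuousLinearMap)

/-- The noncontextuality inequality `∑ i, w i * p i ≤ B` of `G` is a self-test for the realization
`x`: the realization achieves the quantum supremum, and every realization that also achieves it
agrees with `x` up to a global isometry. -/
structure IsSelfTest {n : ℕ} (G : SimpleGraph (Fin n)) (w : Fin n → ℝ) (B : ℝ)
    {K : Type v} [NormedAddCommGroup K] [InnerProductSpace ℂ K] [CompleteSpace K]
    (x : Fin (n + 1) → K) : Prop where
  ineq : IsNoncontextualityInequality G w B
  real : IsRealization G x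
  attains : IsGreatest (value w '' quantumBehaviors.{u} G) (value w (behavior x))
  unique : ∀ (H : Type u) [NormedAddCommGroup H] [InnerProductSpace ℂ H] [CompleteSpace H]
    (y : Fin (n + 1) → H), IsRealization G y →
      value w (behavior y) = quantumSupremum.{u} G w →
      ∃ V : K →ₗᵢ[ℂ] H, ∀ i, conj V (proj (x i)) = proj (y i)

/-- The inequality is an `(ε, r)`-robust self-test for `x`: it is a self-test, and a realization
that is `ε`-close to the quantum supremum is `O(ε ^ r)`-close to `x` in operator norm, up to a
global isometry. The constant is uniform in `ε`, in the Hilbert space and in the realization. -/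
structure IsRobustSelfTest {n : ℕ} (r : ℝ) (G : SimpleGraph (Fin n)) (w : Fin n → ℝ) (B : ℝ)
    {K : Type v} [NormedAddCommGroup K] [InnerProductSpace ℂ K] [CompleteSpace K]
    (x : Fin (n + 1) → K) : Prop where
  selfTest : IsSelfTest.{u} G w B x
  robust : ∃ C : ℝ, ∀ ε : ℝ, 0 < ε →
    ∀ (H : Type u) [NormedAddCommGroup H] [InnerProductSpace ℂ H] [CompleteSpace H]
      (y : Fin (n + 1) → H), IsRealization G y →
        quantumSupremum.{u} G w - ε ≤ value w (behavior y) →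
        ∃ V : K →ₗᵢ[ℂ] H, ∀ i, ‖conj V (proj (x i)) - proj (y i)‖ ≤ C * ε ^ r

end Quantum

/-- The qutrit vectors `u 0 = (1, 0, 0)` and, for `1 ≤ j ≤ n`,
`u j = (cos θ, sin θ sin φ_j, sin θ cos φ_j)` with `φ_j = j π (n - 1) / n`. -/
noncomputable def kcbsVectors (n : ℕ) (θ : ℝ) (j : Fin (n + 1)) : EuclideanSpace ℂ (Fin 3) :=
  let φ : ℝ := (j : ℕ) * Real.pi * ((n : ℝ) - 1) / n
  if j = 0 then !₂[1, 0, 0]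
  else !₂[((Real.cos θ : ℝ) : ℂ), ((Real.sin θ * Real.sin φ : ℝ) : ℂ),
    ((Real.sin θ * Real.cos φ : ℝ) : ℂ)]

end Contextuality

/-!
For an odd cycle, put `t = cos (π / n) / (1 + cos (π / n))`. If `x` is a state and `y j` are its
projections onto consecutively orthogonal lines, then `⟪x, y j⟫ = ‖y j‖ ^ 2` and
`⟪y j, y (j + 1)⟫ = 0`, and the gap `n * t * ‖x‖ ^ 2 - ∑ ‖y j‖ ^ 2` is a quadratic form in the
deviations `y j - t • x`. After the sign change `(-1) ^ j` this is the discrete Laplacian form on an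
antiperiodic sequence, at its lowest eigenvalue. Its kernel consists of the cosine and the sine
mode: subtracting a multiple of the cosine mode makes the sequence vanish at both ends, and dividing by
the positive sine mode (the ground state of the path) exhibits the form as an explicit sum of
squares, `gap_eq_sum_sq`. This gives the bound `n * t` for vectors, hence (by writing
`ρ = S† S` and expanding traces as sums of squares over a Hilbert basis) for all quantum behaviors,
`value_le_of_mem_quantumBehaviors`. The vectors `kcbsVectors` attain it.

The same identity gives robustness. If the gap is `δ ^ 2`, the squares force
`y j = t • x + cos φ_j • A - sin φ_j • B + O(δ)` for two vectors `A`, `B`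
(`exists_norm_sub_le_sqrt_gap`). The relations satisfied by the `y j` become linear equations,
up to `O(δ)`, for the Gram matrix of `x, A, B`; as they have a unique solution
(`ker_gramMap`) and injective linear maps in finite dimension are bounded below, that Gram matrix is
`O(δ)`-close to the optimal one (`exists_gram_stability`). Gram-Schmidt then provides an exact
orthonormal frame near `x, -m⁻¹ • B, m⁻¹ • A` for `m = cos θ sin θ` (`exists_orthonormal_near`), that
is, an isometry from `ℂ³` that carries the optimal projectors to within `O(δ)` of the given ones (`exists_isometry_near`).
All estimates are linear in `δ` without any smallness assumption, so the case `δ = 0` is the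
self-test. For large `δ` an isometry still exists, because odd cycles have no orthogonal
representation by nonzero vectors in dimension two.
-/

namespace Contextuality

/-! ### The sum of squares certificate for the odd cycle -/

section OddCycleForm

variable {E : Type*} [NormedAddCommGroup E] [InnerProductSpace ℝ E]

lemma sin_mul_pi_div_pos {n j : ℕ} (hj : 0 < j) (hjn : j < n) :
    0 < Real.sin (j * (Real.pi / n)) := by
  have hn : (0 : ℝ) < n := by exact_mod_cast hj.trans hjn
  apply Real.sin_pos_of_pos_of_lt_pi
  · have : (0 : ℝ) < j := by exact_mod_cast hj
    positivity
  · have : (j : ℝ) < n := by exact_mod_cast hjn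
    calc (j : ℝ) * (Real.pi / n) < n * (Real.pi / n) := by gcongr
      _ = Real.pi := by field_simp

lemma sin_self_mul_pi_div {n : ℕ} (hn : 0 < n) : Real.sin (n * (Real.pi / n)) = 0 := by
  have : (0 : ℝ) < n := by exact_mod_cast hn
  rw [mul_div_cancel₀ _ this.ne', Real.sin_pi]

lemma cos_self_mul_pi_div {n : ℕ} (hn : 0 < n) : Real.cos (n * (Real.pi / n)) = -1 := by
  have : (0 : ℝ) < n := by exact_mod_cast hn
  rw [mul_div_cancel₀ _ this.ne', Real.cos_pi]

/-- Ground state substitution on a path with Dirichlet boundary: writing `v j = sin (j π / n) • q j`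
turns the discrete Laplacian form at its lowest eigenvalue into a weighted sum of the squares
`‖q j - q (j + 1)‖ ^ 2`. The divisions by `sin 0` and `sin π` are harmless, as the weights vanish
there. -/
lemma sum_path_form_eq {n : ℕ} (hn : 0 < n) (v : ℕ → E) (h0 : v 0 = 0) (hvn : v n = 0) :
    ∑ j ∈ Finset.range n,
        (2 * Real.cos (Real.pi / n) * ‖v j‖ ^ 2 - 2 * inner ℝ (v j) (v (j + 1))) =
      ∑ j ∈ Finset.range n,
        Real.sin (j * (Real.pi / n)) * Real.sin ((j + 1 : ℕ) * (Real.pi / n)) *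
          ‖(Real.sin (j * (Real.pi / n)))⁻¹ • v j -
            (Real.sin ((j + 1 : ℕ) * (Real.pi / n)))⁻¹ • v (j + 1)‖ ^ 2 := by
  set a := Real.pi / n with ha
  -- `p` is the telescoping remainder; `sin (j a - a)` stands for the weight at `j - 1`.
  let p : ℕ → ℝ := fun j => Real.sin (j * a - a) / Real.sin (j * a) * ‖v j‖ ^ 2
  have key : ∀ j ∈ Finset.range n,
      2 * Real.cos a * ‖v j‖ ^ 2 - 2 * inner ℝ (v j) (v (j + 1)) =
      Real.sin (j * a) * Real.sin ((j + 1 : ℕ) * a) *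
          ‖(Real.sin (j * a))⁻¹ • v j - (Real.sin ((j + 1 : ℕ) * a))⁻¹ • v (j + 1)‖ ^ 2 +
        (p j - p (j + 1)) := by
    intro j hj
    have hjn := Finset.mem_range.1 hj
    have e1 : ((j + 1 : ℕ) : ℝ) * a - a = j * a := by push_cast; ring
    -- The sine mode solves the three-term recurrence with eigenvalue `2 cos a`.
    have e2 : 2 * Real.cos a * Real.sin (j * a) =
        Real.sin ((j + 1 : ℕ) * a) + Real.sin (j * a - a) := by
      push_cast
      rw [add_mul, one_mul, Real.sin_add, Real.sin_sub]; ring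
    have e3 : p (j + 1) = Real.sin (j * a) / Real.sin ((j + 1 : ℕ) * a) * ‖v (j + 1)‖ ^ 2 := by
      simp only [p, e1]
    rw [e3]
    rcases Nat.eq_zero_or_pos j with rfl | hjpos
    · simp [p, h0]
    have hs : 0 < Real.sin (j * a) := sin_mul_pi_div_pos hjpos hjn
    rcases Nat.lt_or_ge (j + 1) n with hlt | hge
    · have hs' : 0 < Real.sin ((j + 1 : ℕ) * a) := sin_mul_pi_div_pos (Nat.succ_pos j) hlt
      have e4 : 2 * Real.cos a =
          (Real.sin ((j + 1 : ℕ) * a) + Real.sin (j * a - a)) / Real.sin (j * a) := by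
        rw [← e2]; field_simp
      rw [@norm_sub_sq_real, norm_smul, norm_smul, inner_smul_left, inner_smul_right, e4]
      simp only [p, conj_trivial, mul_pow, norm_inv, inv_pow, Real.norm_eq_abs, sq_abs]
      clear e1 e2 e3 e4
      generalize Real.sin (j * a) = s at hs ⊢
      generalize Real.sin ((j + 1 : ℕ) * a) = s' at hs' ⊢
      field_simp
      ring
    · -- At the last edge `sin π = 0`, so Lean's `(sin π)⁻¹ = 0` only meets `v n = 0`.
      have hjeq : j + 1 = n := by omega
      have hs' : Real.sin ((j + 1 : ℕ) * a) = 0 := by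
        rw [hjeq]; exact sin_self_mul_pi_div hn
      rw [hs', zero_add] at e2
      have e4 : 2 * Real.cos a = Real.sin (j * a - a) / Real.sin (j * a) := by
        rw [← e2]; field_simp
      rw [hs', hjeq, hvn, e4]
      simp [p]
  rw [Finset.sum_congr rfl key, Finset.sum_add_distrib, Finset.sum_range_sub']
  simp [p, h0, hvn]

/-- On antiperiodic sequences the form is unchanged under subtracting its kernel vector
`j ↦ cos (j π / n) • w 0`, which makes both boundary values vanish. -/
lemma sum_antiperiodic_form_eq {n : ℕ} (hn : 0 < n) (w : ℕ → E) (hw : w n = -w 0) :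
    ∑ j ∈ Finset.range n,
        (2 * Real.cos (Real.pi / n) * ‖w j‖ ^ 2 - 2 * inner ℝ (w j) (w (j + 1))) =
      ∑ j ∈ Finset.range n,
        (2 * Real.cos (Real.pi / n) * ‖w j - Real.cos (j * (Real.pi / n)) • w 0‖ ^ 2 -
          2 * inner ℝ (w j - Real.cos (j * (Real.pi / n)) • w 0)
            (w (j + 1) - Real.cos ((j + 1 : ℕ) * (Real.pi / n)) • w 0)) := by
  set a := Real.pi / n with ha
  -- The difference of the two summands telescopes, as the cosine mode solves the recurrence.
  let U : ℕ → ℝ := fun j => 2 * Real.cos (j * a - a) * inner ℝ (w j) (w 0) -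
    Real.cos (j * a) * Real.cos (j * a - a) * ‖w 0‖ ^ 2
  have key : ∀ j ∈ Finset.range n,
      2 * Real.cos a * ‖w j‖ ^ 2 - 2 * inner ℝ (w j) (w (j + 1)) =
        (2 * Real.cos a * ‖w j - Real.cos (j * a) • w 0‖ ^ 2 -
          2 * inner ℝ (w j - Real.cos (j * a) • w 0)
            (w (j + 1) - Real.cos ((j + 1 : ℕ) * a) • w 0)) + (U j - U (j + 1)) := by
    intro j _
    have e1 : ((j + 1 : ℕ) : ℝ) * a - a = j * a := by push_cast; ring
    have e2 : Real.cos (j * a - a) =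
        2 * Real.cos a * Real.cos (j * a) - Real.cos ((j + 1 : ℕ) * a) := by
      push_cast
      rw [add_mul, one_mul, Real.cos_add, Real.cos_sub]; ring
    simp only [U, e1]
    rw [e2, @norm_sub_sq_real]
    simp only [inner_sub_left, inner_sub_right, inner_smul_left, inner_smul_right, norm_smul,
      conj_trivial, mul_pow, Real.norm_eq_abs, sq_abs, real_inner_self_eq_norm_sq]
    rw [real_inner_comm (w (j + 1)) (w 0)]
    ring
  rw [Finset.sum_congr rfl key, Finset.sum_add_distrib, Finset.sum_range_sub']
  have e3 : Real.cos (n * a) = -1 := cos_self_mul_pi_div hn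
  have e4 : Real.cos (n * a - a) = -Real.cos a := by
    rw [Real.cos_sub, e3, sin_self_mul_pi_div hn]; ring
  simp only [U, e3, e4, hw, Nat.cast_zero, zero_mul, zero_sub, Real.cos_neg, Real.cos_zero,
    inner_neg_left, real_inner_self_eq_norm_sq]
  ring

/-- The optimal probability `cos (π / n) / (1 + cos (π / n))` of a single event; the quantum bound
is `n` times this number. -/
noncomputable def kcbsProb (n : ℕ) : ℝ := Real.cos (Real.pi / n) / (1 + Real.cos (Real.pi / n))

lemma cos_pi_div_pos {n : ℕ} (hn : 3 ≤ n) : 0 < Real.cos (Real.pi / n) := by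
  have h3 : (3 : ℝ) ≤ n := by exact_mod_cast hn
  have hpi := Real.pi_pos
  apply Real.cos_pos_of_mem_Ioo
  constructor
  · have : 0 < Real.pi / n := by positivity
    linarith
  · rw [div_lt_div_iff₀ (by positivity) (by norm_num)]
    nlinarith

lemma kcbsProb_pos {n : ℕ} (hn : 3 ≤ n) : 0 < kcbsProb n := by
  have := cos_pi_div_pos hn
  unfold kcbsProb; positivity

lemma kcbsProb_mul {n : ℕ} (hn : 3 ≤ n) :
    kcbsProb n * (1 + Real.cos (Real.pi / n)) = Real.cos (Real.pi / n) := by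
  have := cos_pi_div_pos hn
  unfold kcbsProb; field_simp

/-- The component of the projection `y j` of the state that deviates from its optimal part
`kcbsProb n • x`, with alternating sign. -/
noncomputable def altDeviation (n : ℕ) (x : E) (y : ℕ → E) (j : ℕ) : E :=
  (-1 : ℝ) ^ j • (y j - kcbsProb n • x)

/-- The quotient of the deviation, after subtraction of the cosine mode, by the sine mode. At the
optimum it does not depend on `j`. -/
noncomputable def sineQuotient (n : ℕ) (x : E) (y : ℕ → E) (j : ℕ) : E :=
  (Real.sin (j * (Real.pi / n)))⁻¹ •
    (altDeviation n x y j - Real.cos (j * (Real.pi / n)) • altDeviation n x y 0)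

/-- Sum of squares certificate for the odd cycle: the gap between the quantum bound and the
value is an explicit nonnegative combination of squares. Vertex `j` carries the projection `y j` of
the state `x`, and vertex `n` is vertex `0`. -/
lemma gap_eq_sum_sq {n : ℕ} (hodd : Odd n) (hn : 3 ≤ n) (x : E) (y : ℕ → E)
    (hxy : ∀ j, inner ℝ x (y j) = ‖y j‖ ^ 2) (hyy : ∀ j, inner ℝ (y j) (y (j + 1)) = 0)
    (hper : y n = y 0) :
    2 * Real.cos (Real.pi / n) *
        (n * kcbsProb n * ‖x‖ ^ 2 - ∑ j ∈ Finset.range n, ‖y j‖ ^ 2) =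
      ∑ j ∈ Finset.range n,
        Real.sin (j * (Real.pi / n)) * Real.sin ((j + 1 : ℕ) * (Real.pi / n)) *
          ‖sineQuotient n x y j - sineQuotient n x y (j + 1)‖ ^ 2 := by
  have hn0 : 0 < n := by omega
  have ht := kcbsProb_mul hn
  have hwn : altDeviation n x y n = -altDeviation n x y 0 := by
    simp [altDeviation, hodd.neg_one_pow, hper]
  have hsum := sum_path_form_eq hn0
    (fun j => altDeviation n x y j - Real.cos (j * (Real.pi / n)) • altDeviation n x y 0)
    (by simp) (by rw [hwn, cos_self_mul_pi_div hn0]; simp)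
  rw [← sum_antiperiodic_form_eq hn0 _ hwn] at hsum
  refine Eq.trans ?_ hsum
  -- Orthogonality of neighbours and `⟪x, y j⟫ = ‖y j‖ ^ 2` turn each summand into a summand of the
  -- gap, up to a term that telescopes around the cycle.
  have key : ∀ j ∈ Finset.range n,
      2 * Real.cos (Real.pi / n) * ‖altDeviation n x y j‖ ^ 2 -
        2 * inner ℝ (altDeviation n x y j) (altDeviation n x y (j + 1)) =
      2 * Real.cos (Real.pi / n) * (kcbsProb n * ‖x‖ ^ 2 - ‖y j‖ ^ 2) +
        (2 * kcbsProb n * ‖y j‖ ^ 2 - 2 * kcbsProb n * ‖y (j + 1)‖ ^ 2) := by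
    intro j _
    have h1 : (-1 : ℝ) ^ j * (-1 : ℝ) ^ j = 1 := by rw [← mul_pow]; simp
    have h2 : ‖altDeviation n x y j‖ ^ 2 =
        ‖y j‖ ^ 2 - 2 * kcbsProb n * ‖y j‖ ^ 2 + kcbsProb n ^ 2 * ‖x‖ ^ 2 := by
      rw [altDeviation, norm_smul, norm_pow, norm_neg, norm_one, one_pow, one_mul,
        norm_sub_sq_real, inner_smul_right, real_inner_comm, hxy, norm_smul, mul_pow,
        Real.norm_eq_abs, sq_abs]
      ring
    have h3 : inner ℝ (altDeviation n x y j) (altDeviation n x y (j + 1)) =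
        kcbsProb n * (‖y j‖ ^ 2 + ‖y (j + 1)‖ ^ 2) - kcbsProb n ^ 2 * ‖x‖ ^ 2 := by
      simp only [altDeviation, inner_smul_left, inner_smul_right, conj_trivial, inner_sub_left,
        inner_sub_right, hyy, real_inner_comm x (y j), hxy, real_inner_self_eq_norm_sq, pow_succ]
      linear_combination
        (kcbsProb n * (‖y j‖ ^ 2 + ‖y (j + 1)‖ ^ 2) - kcbsProb n ^ 2 * ‖x‖ ^ 2) * h1
    rw [h2, h3]
    linear_combination (2 * kcbsProb n * ‖x‖ ^ 2 - 4 * ‖y j‖ ^ 2) * ht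
  rw [Finset.sum_congr rfl key, Finset.sum_add_distrib, Finset.sum_range_sub', hper, sub_self,
    add_zero, ← Finset.mul_sum, Finset.sum_sub_distrib]
  simp [mul_assoc]

end OddCycleForm

/-! ### Approximate shape of near-optimal vectors -/

section Stability

lemma sin_mul_pi_div_nonneg {n j : ℕ} (hj : j ≤ n) : 0 ≤ Real.sin (j * (Real.pi / n)) := by
  rcases Nat.eq_zero_or_pos j with rfl | h
  · simp
  rcases hj.lt_or_eq with h' | rfl
  · exact (sin_mul_pi_div_pos h h').le
  · exact (sin_self_mul_pi_div h).ge

section Real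

variable {E : Type*} [NormedAddCommGroup E] [InnerProductSpace ℝ E]

lemma gap_summand_nonneg {n j : ℕ} (hj : j < n) (x : E) (y : ℕ → E) :
    0 ≤ Real.sin (j * (Real.pi / n)) * Real.sin ((j + 1 : ℕ) * (Real.pi / n)) *
      ‖sineQuotient n x y j - sineQuotient n x y (j + 1)‖ ^ 2 :=
  mul_nonneg (mul_nonneg (sin_mul_pi_div_nonneg hj.le) (sin_mul_pi_div_nonneg hj)) (sq_nonneg _)

lemma gap_summand_le {n : ℕ} (hodd : Odd n) (hn : 3 ≤ n) (x : E) (y : ℕ → E)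
    (hxy : ∀ j, inner ℝ x (y j) = ‖y j‖ ^ 2) (hyy : ∀ j, inner ℝ (y j) (y (j + 1)) = 0)
    (hper : y n = y 0) {j : ℕ} (hj : j < n) :
    Real.sin (j * (Real.pi / n)) * Real.sin ((j + 1 : ℕ) * (Real.pi / n)) *
      ‖sineQuotient n x y j - sineQuotient n x y (j + 1)‖ ^ 2 ≤
    2 * Real.cos (Real.pi / n) *
        (n * kcbsProb n * ‖x‖ ^ 2 - ∑ j ∈ Finset.range n, ‖y j‖ ^ 2) := by
  rw [gap_eq_sum_sq hodd hn x y hxy hyy hper]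
  exact Finset.single_le_sum (f := fun j : ℕ =>
    Real.sin (j * (Real.pi / n)) * Real.sin ((j + 1 : ℕ) * (Real.pi / n)) *
      ‖sineQuotient n x y j - sineQuotient n x y (j + 1)‖ ^ 2)
    (fun i hi => gap_summand_nonneg (Finset.mem_range.1 hi) x y) (Finset.mem_range.2 hj)

/-- The quantum bound for the odd cycle, in terms of the projections `y j` of a state `x`. -/
lemma sum_norm_sq_le {n : ℕ} (hodd : Odd n) (hn : 3 ≤ n) (x : E) (y : ℕ → E)
    (hxy : ∀ j, inner ℝ x (y j) = ‖y j‖ ^ 2) (hyy : ∀ j, inner ℝ (y j) (y (j + 1)) = 0)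
    (hper : y n = y 0) :
    ∑ j ∈ Finset.range n, ‖y j‖ ^ 2 ≤ n * kcbsProb n * ‖x‖ ^ 2 := by
  have hc := cos_pi_div_pos hn
  have h0 := (gap_summand_nonneg (show 0 < n by omega) x y).trans
    (gap_summand_le hodd hn x y hxy hyy hper (show 0 < n by omega))
  have := (mul_nonneg_iff_of_pos_left (by positivity : 0 < 2 * Real.cos (Real.pi / n))).1 h0
  linarith

end Real

/-- `cos φ_j` for the angle `φ_j = j π (n - 1) / n`, written as `(-1) ^ j * cos (j π / n)`. -/
noncomputable def altCos (n j : ℕ) : ℝ := (-1) ^ j * Real.cos (j * (Real.pi / n))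

/-- `-sin φ_j` for the angle `φ_j = j π (n - 1) / n`, written as `(-1) ^ j * sin (j π / n)`. -/
noncomputable def altSin (n j : ℕ) : ℝ := (-1) ^ j * Real.sin (j * (Real.pi / n))

lemma exists_inv_sin_mul_sin_le (n : ℕ) : ∃ M : ℝ, 0 ≤ M ∧ ∀ j < n,
    (Real.sin (j * (Real.pi / n)) * Real.sin ((j + 1 : ℕ) * (Real.pi / n)))⁻¹ ≤ M := by
  have hterm : ∀ j ∈ Finset.range n,
      0 ≤ (Real.sin (j * (Real.pi / n)) * Real.sin ((j + 1 : ℕ) * (Real.pi / n)))⁻¹ :=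
    fun j hj => inv_nonneg.2 (mul_nonneg (sin_mul_pi_div_nonneg (Finset.mem_range.1 hj).le)
      (sin_mul_pi_div_nonneg (Finset.mem_range.1 hj)))
  exact ⟨_, Finset.sum_nonneg hterm,
    fun j hj => Finset.single_le_sum hterm (Finset.mem_range.2 hj)⟩

/-- A small gap forces the projections `y j` of the state to be close to vectors of the optimal
shape, with `A` and `B` not yet controlled. -/
lemma exists_norm_sub_le_sqrt_gap {n : ℕ} (hodd : Odd n) (hn : 3 ≤ n) :
    ∃ K : ℝ, 0 ≤ K ∧ ∀ (E : Type u) [NormedAddCommGroup E] [InnerProductSpace ℝ E]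
      (x : E) (y : ℕ → E), (∀ j, inner ℝ x (y j) = ‖y j‖ ^ 2) →
      (∀ j, inner ℝ (y j) (y (j + 1)) = 0) → y n = y 0 → ∀ j < n,
      ‖y j - (kcbsProb n • x + altCos n j • altDeviation n x y 0 +
        altSin n j • sineQuotient n x y 1)‖ ≤
      K * √(n * kcbsProb n * ‖x‖ ^ 2 - ∑ j ∈ Finset.range n, ‖y j‖ ^ 2) := by
  obtain ⟨M, hM0, hM⟩ := exists_inv_sin_mul_sin_le n
  have hc := cos_pi_div_pos hn
  refine ⟨n * √(M * (2 * Real.cos (Real.pi / n))), by positivity, ?_⟩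
  intro E _ _ x y hxy hyy hper
  have hsummand := fun j (hj : j < n) => gap_summand_le hodd hn x y hxy hyy hper hj
  generalize n * kcbsProb n * ‖x‖ ^ 2 - ∑ j ∈ Finset.range n, ‖y j‖ ^ 2 = D at hsummand ⊢
  obtain ⟨q, hq⟩ : ∃ q, q = sineQuotient n x y := ⟨_, rfl⟩
  rw [← hq] at hsummand ⊢
  obtain ⟨d, hd⟩ : ∃ d, d = √(M * (2 * Real.cos (Real.pi / n))) * √D := ⟨_, rfl⟩
  have hd0 : 0 ≤ d := by rw [hd]; positivity
  have hstep : ∀ j, 0 < j → j + 1 < n → ‖q j - q (j + 1)‖ ≤ d := by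
    intro j hj hjn
    have h1 := sin_mul_pi_div_pos hj (show j < n by omega)
    have h2 := sin_mul_pi_div_pos (show 0 < j + 1 by omega) hjn
    have h3 := mul_pos h1 h2
    have hle := hsummand j (by omega)
    have hMle : (Real.sin (j * (Real.pi / n)) * Real.sin ((j + 1 : ℕ) * (Real.pi / n)))⁻¹ ≤ M :=
      hM j (by omega)
    generalize Real.sin (j * (Real.pi / n)) * Real.sin ((j + 1 : ℕ) * (Real.pi / n)) = σ
      at h3 hle hMle
    rw [hd, ← Real.sqrt_mul (mul_nonneg hM0 (by positivity))]
    apply Real.le_sqrt_of_sq_le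
    calc ‖q j - q (j + 1)‖ ^ 2 = σ⁻¹ * (σ * ‖q j - q (j + 1)‖ ^ 2) := by field_simp
      _ ≤ M * (2 * Real.cos (Real.pi / n) * D) := by gcongr
      _ = _ := by ring
  have hchain : ∀ j, j + 1 < n → ‖q (j + 1) - q 1‖ ≤ j * d := by
    intro j
    induction j with
    | zero => simp
    | succ j ih =>
      intro hj
      have h1 := ih (by omega)
      have h2 := hstep (j + 1) (by omega) hj
      rw [norm_sub_rev] at h2
      calc ‖q (j + 1 + 1) - q 1‖ ≤ ‖q (j + 1 + 1) - q (j + 1)‖ + ‖q (j + 1) - q 1‖ :=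
            norm_sub_le_norm_sub_add_norm_sub _ _ _
        _ ≤ d + j * d := add_le_add h2 h1
        _ = _ := by push_cast; ring
  have hsgn : ∀ j : ℕ, (-1 : ℝ) ^ j * (-1 : ℝ) ^ j = 1 := fun j => by rw [← mul_pow]; simp
  intro j hj
  have hrw : n * √(M * (2 * Real.cos (Real.pi / n))) * √D = n * d := by rw [hd]; ring
  rw [hrw]
  rcases j with _ | j
  · have : y 0 - (kcbsProb n • x + altCos n 0 • altDeviation n x y 0 + altSin n 0 • q 1) = 0 := by
      simp [altCos, altSin, altDeviation]
    rw [this, norm_zero]; positivity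
  · have hsj := sin_mul_pi_div_pos (Nat.succ_pos j) hj
    have hw : altDeviation n x y (j + 1) = Real.cos ((j + 1 : ℕ) * (Real.pi / n)) •
        altDeviation n x y 0 + Real.sin ((j + 1 : ℕ) * (Real.pi / n)) • q (j + 1) := by
      rw [hq, sineQuotient, smul_smul, mul_inv_cancel₀ hsj.ne']
      simp
    have hy : y (j + 1) = kcbsProb n • x + (-1 : ℝ) ^ (j + 1) • altDeviation n x y (j + 1) := by
      rw [altDeviation, smul_smul, hsgn]; simp
    have : y (j + 1) - (kcbsProb n • x + altCos n (j + 1) • altDeviation n x y 0 +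
        altSin n (j + 1) • q 1) = altSin n (j + 1) • (q (j + 1) - q 1) := by
      rw [hy, hw, altCos, altSin]; module
    rw [this, norm_smul]
    have h1 : ‖altSin n (j + 1)‖ ≤ 1 := by
      rw [altSin, norm_mul, norm_pow, norm_neg, norm_one, one_pow, one_mul]
      exact Real.abs_sin_le_one _
    calc _ ≤ 1 * (j * d) := by gcongr; exact hchain j hj
      _ ≤ n * d := by
        rw [one_mul]; gcongr; omega

/-- The part of `⟪x, y⟫ - ‖y‖ ^ 2` that is linear in the Gram data, for
`y = t • x + C • A + S • B` with `‖x‖ = 1`. The data are `⟪x, A⟫`, `⟪x, B⟫`, `⟪A, B⟫`,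
`‖A‖ ^ 2 - μ`, `‖B‖ ^ 2 - μ` for a fixed real `μ`. -/
noncomputable def gramDiag (t C S : ℝ) (p : ℂ × ℂ × ℂ × ℝ × ℝ) : ℂ :=
  C * p.1 + S * p.2.1 - ((2 * t * (C * p.1.re + S * p.2.1.re) +
    (C ^ 2 * p.2.2.2.1 + S ^ 2 * p.2.2.2.2 + 2 * C * S * p.2.2.1.re) : ℝ) : ℂ)

/-- The part of `⟪y, y'⟫` that is linear in the Gram data (see `gramDiag`), for
`y = t • x + C • A + S • B` and `y' = t • x + C' • A + S' • B` with `‖x‖ = 1`. -/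
noncomputable def gramOff (t C S C' S' : ℝ) (p : ℂ × ℂ × ℂ × ℝ × ℝ) : ℂ :=
  t * (C' * p.1 + S' * p.2.1) + t * (C * star p.1 + S * star p.2.1) +
    (C * C' * p.2.2.2.1 + S * S' * p.2.2.2.2 + C * S' * p.2.2.1 + S * C' * star p.2.2.1)

/-- Five diagonal conditions, at the angles `0`, `±φ₁`, `±φ₂`, and one orthogonality condition. -/
noncomputable def gramMap (t C₁ S₁ C₂ S₂ : ℝ) : (ℂ × ℂ × ℂ × ℝ × ℝ) →ₗ[ℝ] (Fin 6 → ℂ) where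
  toFun p := ![gramDiag t 1 0 p, gramDiag t C₁ S₁ p, gramDiag t C₁ (-S₁) p, gramDiag t C₂ S₂ p,
    gramDiag t C₂ (-S₂) p, gramOff t 1 0 C₁ S₁ p]
  map_add' p q := by
    ext i; fin_cases i <;> simp [gramDiag, gramOff] <;> ring
  map_smul' r p := by
    ext i; fin_cases i <;> simp [gramDiag, gramOff] <;> ring

/-- The linearized conditions determine the Gram data. Differences of the conditions at `±φ` isolate
`⟪x, B⟫` and the real part of `⟪A, B⟫`; sums give a quadratic polynomial in `cos φ` with three
zeros; the orthogonality condition removes the imaginary part of `⟪A, B⟫`. -/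
lemma ker_gramMap {t C₁ S₁ C₂ S₂ : ℝ} (ht : t ≠ 1 / 2) (h₁ : C₁ ^ 2 + S₁ ^ 2 = 1)
    (h₂ : C₂ ^ 2 + S₂ ^ 2 = 1) (hS₁ : S₁ ≠ 0) (hS₂ : S₂ ≠ 0) (hC : C₁ ≠ C₂) :
    (gramMap t C₁ S₁ C₂ S₂).ker = ⊥ := by
  rw [LinearMap.ker_eq_bot']
  rintro ⟨α, β, κ, a, b⟩ hp
  have e0 := congrFun hp 0
  have e1 := congrFun hp 1
  have e2 := congrFun hp 2
  have e3 := congrFun hp 3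
  have e4 := congrFun hp 4
  have e5 := congrFun hp 5
  simp only [gramMap, LinearMap.coe_mk, AddHom.coe_mk, Matrix.cons_val, Pi.zero_apply, gramDiag,
    gramOff, Complex.ext_iff, pow_two] at e0 e1 e2 e3 e4 e5
  simp at e0 e1 e2 e3 e4 e5
  obtain ⟨r0, i0⟩ := e0
  obtain ⟨r1, i1⟩ := e1
  obtain ⟨r2, -⟩ := e2
  obtain ⟨r3, -⟩ := e3
  obtain ⟨r4, -⟩ := e4
  obtain ⟨r5, i5⟩ := e5
  have hβi : β.im = 0 := by simpa [i0, hS₁] using i1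
  have o1 : (1 - 2 * t) * β.re = 2 * C₁ * κ.re :=
    mul_left_cancel₀ hS₁ (by linear_combination (r1 - r2) / 2)
  have o2 : (1 - 2 * t) * β.re = 2 * C₂ * κ.re :=
    mul_left_cancel₀ hS₂ (by linear_combination (r3 - r4) / 2)
  have hκr : κ.re = 0 :=
    mul_left_cancel₀ (sub_ne_zero.2 hC) (by linear_combination (o2 - o1) / 2)
  have ht' : 1 - 2 * t ≠ 0 := fun h => ht (by linarith)
  have hβr : β.re = 0 := mul_left_cancel₀ ht' (by rw [o1, hκr]; ring)
  have hC1 : 1 - C₁ ≠ 0 := fun h => hS₁ (by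
    have : C₁ = 1 := by linarith
    rw [this] at h₁; exact pow_eq_zero_iff (two_ne_zero) |>.1 (by linarith))
  have hC2 : 1 - C₂ ≠ 0 := fun h => hS₂ (by
    have : C₂ = 1 := by linarith
    rw [this] at h₂; exact pow_eq_zero_iff (two_ne_zero) |>.1 (by linarith))
  have q1 : C₁ * a = (1 + C₁) * b :=
    mul_left_cancel₀ hC1 (by linear_combination (r1 + r2) / 2 - C₁ * r0 + b * h₁)
  have q2 : C₂ * a = (1 + C₂) * b :=
    mul_left_cancel₀ hC2 (by linear_combination (r3 + r4) / 2 - C₂ * r0 + b * h₂)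
  have hab : a = b := mul_left_cancel₀ (sub_ne_zero.2 hC) (by linear_combination q1 - q2)
  have hb : b = 0 := by rw [hab] at q1; linarith
  have ha : a = 0 := hab.trans hb
  have hαr : α.re = 0 := mul_left_cancel₀ ht' (by rw [ha] at r0; linear_combination r0)
  have hκi : κ.im = 0 := mul_left_cancel₀ hS₁ (by
    simp only [i0, hβi] at i5
    linear_combination i5)
  simp [Prod.ext_iff, Complex.ext_iff, *]

end Stability

/-! ### Stability of the Gram matrix -/

section Gram

variable {H : Type u} [NormedAddCommGroup H] [InnerProductSpace ℂ H]

lemma altCos_sq_add_altSin_sq (n j : ℕ) : altCos n j ^ 2 + altSin n j ^ 2 = 1 := by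
  have h : ((-1 : ℝ) ^ j) ^ 2 = 1 := by rw [← pow_mul, mul_comm, pow_mul]; simp
  rw [altCos, altSin, mul_pow, mul_pow, h, one_mul, one_mul, Real.cos_sq_add_sin_sq]

lemma neg_one_pow_sub_of_odd {n k : ℕ} (hodd : Odd n) (hk : k ≤ n) :
    (-1 : ℝ) ^ (n - k) = -(-1) ^ k := by
  have h1 : (-1 : ℝ) ^ (n - k) * (-1) ^ k = -1 := by
    rw [← pow_add, Nat.sub_add_cancel hk, hodd.neg_one_pow]
  have h2 : (-1 : ℝ) ^ k * (-1) ^ k = 1 := by rw [← mul_pow]; simp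
  calc (-1 : ℝ) ^ (n - k) = (-1 : ℝ) ^ (n - k) * ((-1) ^ k * (-1) ^ k) := by rw [h2, mul_one]
    _ = -(-1) ^ k := by rw [← mul_assoc, h1]; ring

lemma sub_mul_pi_div {n k : ℕ} (hn : 0 < n) (hk : k ≤ n) :
    ((n - k : ℕ) : ℝ) * (Real.pi / n) = Real.pi - k * (Real.pi / n) := by
  have : (n : ℝ) ≠ 0 := by exact_mod_cast hn.ne'
  rw [Nat.cast_sub hk]; field_simp

lemma altCos_sub {n k : ℕ} (hodd : Odd n) (hk : k ≤ n) : altCos n (n - k) = altCos n k := by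
  rw [altCos, neg_one_pow_sub_of_odd hodd hk, sub_mul_pi_div hodd.pos hk, Real.cos_pi_sub, altCos]
  ring

lemma altSin_sub {n k : ℕ} (hodd : Odd n) (hk : k ≤ n) : altSin n (n - k) = -altSin n k := by
  rw [altSin, neg_one_pow_sub_of_odd hodd hk, sub_mul_pi_div hodd.pos hk, Real.sin_pi_sub, altSin]
  ring

lemma altSin_ne_zero {n j : ℕ} (hj : 0 < j) (hjn : j < n) : altSin n j ≠ 0 :=
  mul_ne_zero (pow_ne_zero _ (by norm_num)) (sin_mul_pi_div_pos hj hjn).ne'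

lemma abs_altCos_le (n j : ℕ) : |altCos n j| ≤ 1 := by
  rw [← sq_le_one_iff_abs_le_one]; nlinarith [altCos_sq_add_altSin_sq n j, sq_nonneg (altSin n j)]

lemma abs_altSin_le (n j : ℕ) : |altSin n j| ≤ 1 := by
  rw [← sq_le_one_iff_abs_le_one]; nlinarith [altCos_sq_add_altSin_sq n j, sq_nonneg (altCos n j)]

lemma kcbsProb_lt_half {n : ℕ} (hn : 3 ≤ n) : kcbsProb n < 1 / 2 := by
  have hc := cos_pi_div_pos hn
  have hpos : (0 : ℝ) < Real.pi / n := by have := Real.pi_pos; positivity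
  have hlt : Real.cos (Real.pi / n) < 1 := by
    rw [← Real.cos_zero]
    apply Real.cos_lt_cos_of_nonneg_of_le_pi le_rfl _ hpos
    exact div_le_self Real.pi_pos.le (by exact_mod_cast (by omega : 1 ≤ n))
  rw [kcbsProb, div_lt_div_iff₀ (by linarith) (by norm_num)]
  linarith

lemma altCos_one_ne_altCos_two {n : ℕ} (hn : 4 ≤ n) : altCos n 1 ≠ altCos n 2 := by
  have h2 : 0 ≤ Real.cos (2 * (Real.pi / n)) := by
    have h4 : (4 : ℝ) ≤ n := by exact_mod_cast hn
    have hpi := Real.pi_pos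
    apply Real.cos_nonneg_of_mem_Icc
    constructor
    · have : 0 < 2 * (Real.pi / n) := by positivity
      linarith
    · rw [← mul_div_assoc, div_le_div_iff₀ (by linarith) (by norm_num)]
      nlinarith
  have h1 := cos_pi_div_pos (n := n) (by omega)
  simp only [altCos, pow_one, Nat.cast_one, one_mul, Nat.cast_ofNat]
  intro h
  norm_num at h
  linarith

/-- The Gram data of `A` and `B` relative to the state `x`, as deviations from their optimal
values. -/
noncomputable def gramData (μ : ℝ) (x A B : H) : ℂ × ℂ × ℂ × ℝ × ℝ :=
  (inner ℂ x A, inner ℂ x B, inner ℂ A B, ‖A‖ ^ 2 - μ, ‖B‖ ^ 2 - μ)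

lemma inner_self_eq_ofReal (x : H) : inner ℂ x x = ((‖x‖ ^ 2 : ℝ) : ℂ) := by
  rw [inner_self_eq_norm_sq_to_K]; push_cast; rfl

lemma gramDiag_gramData {t C S : ℝ} (hCS : C ^ 2 + S ^ 2 = 1) {x : H} (hx : ‖x‖ = 1) (A B : H) :
    gramDiag t C S (gramData (t - t ^ 2) x A B) =
      inner ℂ x (t • x + C • A + S • B) - ((‖t • x + C • A + S • B‖ ^ 2 : ℝ) : ℂ) := by
  have hre := congrArg Complex.re (inner_self_eq_ofReal (t • x + C • A + S • B))
  rw [Complex.ofReal_re] at hre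
  rw [← hre]
  have hA := inner_self_eq_ofReal A
  have hB := inner_self_eq_ofReal B
  have hX := inner_self_eq_ofReal x
  simp only [← Complex.coe_smul, ← inner_conj_symm A x, ← inner_conj_symm B x,
    ← inner_conj_symm B A,
    inner_add_left, inner_add_right, inner_smul_left, inner_smul_right, hA, hB, hX, hx, gramDiag,
    gramData]
  apply Complex.ext
  · simp [pow_two]
    have s1 : (inner ℂ A x).re = (inner ℂ x A).re := inner_re_symm (𝕜 := ℂ) A x
    have s2 : (inner ℂ B x).re = (inner ℂ x B).re := inner_re_symm (𝕜 := ℂ) B x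
    have s3 : (inner ℂ B A).re = (inner ℂ A B).re := inner_re_symm (𝕜 := ℂ) B A
    rw [s1, s2, s3]
    linear_combination (t - t ^ 2) * hCS
  · simp [pow_two]

lemma gramOff_gramData {t C S C' S' : ℝ} (h : t ^ 2 + (t - t ^ 2) * (C * C' + S * S') = 0) {x : H}
    (hx : ‖x‖ = 1) (A B : H) :
    gramOff t C S C' S' (gramData (t - t ^ 2) x A B) =
      inner ℂ (t • x + C • A + S • B) (t • x + C' • A + S' • B) := by
  have hA := inner_self_eq_ofReal A
  have hB := inner_self_eq_ofReal B
  have hX := inner_self_eq_ofReal x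
  have h' : (t : ℂ) ^ 2 + (t - t ^ 2) * (C * C' + S * S') = 0 := by exact_mod_cast h
  simp only [← Complex.coe_smul, ← inner_conj_symm A x, ← inner_conj_symm B x,
    ← inner_conj_symm B A,
    inner_add_left, inner_add_right, inner_smul_left, inner_smul_right, hA, hB, hX, hx, gramOff,
    gramData]
  simp
  linear_combination (-1 : ℂ) * h'

lemma norm_le_one_of_inner_eq {x y : H} (hx : ‖x‖ = 1) (h : inner ℂ x y = ((‖y‖ ^ 2 : ℝ) : ℂ)) :
    ‖y‖ ≤ 1 := by
  have h1 := norm_inner_le_norm (𝕜 := ℂ) x y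
  rw [h, hx, one_mul, Complex.norm_real, Real.norm_eq_abs, abs_of_nonneg (sq_nonneg _)] at h1
  by_contra hlt
  push Not at hlt
  nlinarith

lemma norm_inner_sub_norm_sq_le {x y y' : H} (hx : ‖x‖ = 1)
    (h : inner ℂ x y = ((‖y‖ ^ 2 : ℝ) : ℂ)) {R η : ℝ} (hR : ‖y'‖ ≤ R) (hη : ‖y - y'‖ ≤ η) :
    ‖inner ℂ x y' - ((‖y'‖ ^ 2 : ℝ) : ℂ)‖ ≤ (2 + R) * η := by
  have hη0 : 0 ≤ η := (norm_nonneg _).trans hη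
  have hR0 : 0 ≤ R := (norm_nonneg _).trans hR
  have hy := norm_le_one_of_inner_eq hx h
  have e : inner ℂ x y' - ((‖y'‖ ^ 2 : ℝ) : ℂ) =
      (((‖y‖ - ‖y'‖) * (‖y‖ + ‖y'‖) : ℝ) : ℂ) - inner ℂ x (y - y') := by
    rw [inner_sub_right, h]; push_cast; ring
  rw [e]
  refine (norm_sub_le _ _).trans ?_
  have h1 : ‖inner ℂ x (y - y')‖ ≤ η := by
    refine (norm_inner_le_norm _ _).trans ?_
    rwa [hx, one_mul]
  have h2 : ‖(((‖y‖ - ‖y'‖) * (‖y‖ + ‖y'‖) : ℝ) : ℂ)‖ ≤ η * (1 + R) := by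
    rw [Complex.norm_real, norm_mul]
    have h3 : ‖‖y‖ - ‖y'‖‖ ≤ η := (abs_norm_sub_norm_le y y').trans hη
    have h4 : ‖‖y‖ + ‖y'‖‖ ≤ 1 + R := by
      rw [Real.norm_eq_abs, abs_of_nonneg (by positivity)]; gcongr
    gcongr
  linarith

lemma norm_inner_le_of_orthogonal {y₁ y₂ y₁' y₂' : H} (h : inner ℂ y₁ y₂ = 0) (hy : ‖y₁‖ ≤ 1)
    {R η : ℝ} (hR : ‖y₂'‖ ≤ R) (h₁ : ‖y₁ - y₁'‖ ≤ η) (h₂ : ‖y₂ - y₂'‖ ≤ η) :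
    ‖inner ℂ y₁' y₂'‖ ≤ (2 + R) * η := by
  have hη0 : 0 ≤ η := (norm_nonneg _).trans h₁
  have e : inner ℂ y₁' y₂' = -(inner ℂ (y₁ - y₁') y₂' + inner ℂ y₁ (y₂ - y₂')) := by
    simp only [inner_sub_left, inner_sub_right, h]; ring
  rw [e, norm_neg]
  refine (norm_add_le _ _).trans ?_
  have h3 : ‖inner ℂ (y₁ - y₁') y₂'‖ ≤ η * R := (norm_inner_le_norm _ _).trans (by gcongr)
  have h4 : ‖inner ℂ y₁ (y₂ - y₂')‖ ≤ 1 * η := (norm_inner_le_norm _ _).trans (by gcongr)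
  linarith

/-- In a near-optimal realization, the projections of the state are close to the
vectors `t • x + C_j • A + S_j • B`, where `x, A, B` have nearly the optimal Gram matrix. -/
lemma exists_gram_stability {n : ℕ} (hodd : Odd n) (hn : 5 ≤ n) :
    ∃ K : ℝ, 0 ≤ K ∧ ∀ (H : Type u) [NormedAddCommGroup H] [InnerProductSpace ℂ H]
      (x : H) (y : ℕ → H), ‖x‖ = 1 → (∀ j, inner ℂ x (y j) = ((‖y j‖ ^ 2 : ℝ) : ℂ)) →
      (∀ j, inner ℂ (y j) (y (j + 1)) = 0) → y n = y 0 → ∃ A B : H, ‖B‖ ≤ K ∧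
      (∀ j < n, ‖y j - (kcbsProb n • x + altCos n j • A + altSin n j • B)‖ ≤
        K * √(n * kcbsProb n - ∑ j ∈ Finset.range n, ‖y j‖ ^ 2)) ∧
      ‖gramData (kcbsProb n - kcbsProb n ^ 2) x A B‖ ≤
        K * √(n * kcbsProb n - ∑ j ∈ Finset.range n, ‖y j‖ ^ 2) := by
  have hn3 : 3 ≤ n := by omega
  obtain ⟨K₀, hK₀, hclose⟩ := exists_norm_sub_le_sqrt_gap.{u} hodd hn3
  set t := kcbsProb n with ht
  have ht0 : 0 < t := kcbsProb_pos hn3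
  have ht1 : t < 1 / 2 := kcbsProb_lt_half hn3
  have hs1 : 0 < Real.sin ((1 : ℕ) * (Real.pi / n)) := sin_mul_pi_div_pos one_pos (by omega)
  obtain ⟨b, hb⟩ : ∃ b, b = (Real.sin ((1 : ℕ) * (Real.pi / n)))⁻¹ * 4 := ⟨_, rfl⟩
  have hb0 : 0 ≤ b := by rw [hb]; positivity
  obtain ⟨L, -, hL⟩ := (gramMap t (altCos n 1) (altSin n 1) (altCos n 2)
    (altSin n 2)).exists_antilipschitzWith (ker_gramMap ht1.ne (altCos_sq_add_altSin_sq n 1)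
      (altCos_sq_add_altSin_sq n 2) (altSin_ne_zero one_pos (by omega))
      (altSin_ne_zero two_pos (by omega)) (altCos_one_ne_altCos_two (by omega)))
  refine ⟨max b (max K₀ (L * (K₀ * (5 + b)))), by positivity, ?_⟩
  intro H _ _ x y hx hxy hyy hper
  let _ : InnerProductSpace ℝ H := InnerProductSpace.complexToReal
  have hxyR : ∀ j, inner ℝ x (y j) = ‖y j‖ ^ 2 := fun j => by
    rw [real_inner_eq_re_inner ℂ, hxy]; exact Complex.ofReal_re _
  have hyyR : ∀ j, inner ℝ (y j) (y (j + 1)) = 0 := fun j => by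
    rw [real_inner_eq_re_inner ℂ, hyy]; simp
  have hcl := hclose H x y hxyR hyyR hper
  rw [hx, one_pow, mul_one] at hcl
  have hy1 : ∀ j, ‖y j‖ ≤ 1 := fun j => norm_le_one_of_inner_eq hx (hxy j)
  have hdev : ∀ j, ‖altDeviation n x y j‖ ≤ 2 := by
    intro j
    rw [altDeviation, norm_smul, norm_pow, norm_neg, norm_one, one_pow, one_mul]
    refine (norm_sub_le _ _).trans ?_
    rw [norm_smul, hx, Real.norm_eq_abs, abs_of_pos ht0]
    linarith [hy1 j]
  have hB : ‖sineQuotient n x y 1‖ ≤ b := by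
    rw [sineQuotient, norm_smul, norm_inv, Real.norm_eq_abs, abs_of_pos hs1, hb]
    gcongr
    refine (norm_sub_le _ _).trans ?_
    rw [norm_smul]
    have := Real.abs_cos_le_one ((1 : ℕ) * (Real.pi / n))
    have h3 : ‖Real.cos ((1 : ℕ) * (Real.pi / n))‖ * ‖altDeviation n x y 0‖ ≤ 1 * 2 := by
      gcongr
      · exact this
      · exact hdev 0
    linarith [hdev 1]
  have hA := hdev 0
  have hδ := Real.sqrt_nonneg (n * t - ∑ j ∈ Finset.range n, ‖y j‖ ^ 2)
  generalize √(n * t - ∑ j ∈ Finset.range n, ‖y j‖ ^ 2) = δ at hδ hcl ⊢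
  generalize altDeviation n x y 0 = A at hcl hA ⊢
  generalize sineQuotient n x y 1 = B at hcl hB ⊢
  refine ⟨A, B, hB.trans (le_max_left _ _), fun j hj => (hcl j hj).trans ?_, ?_⟩
  · gcongr
    exact (le_max_left _ _).trans (le_max_right _ _)
  have hR : ∀ j, ‖t • x + altCos n j • A + altSin n j • B‖ ≤ 3 + b := by
    intro j
    refine (norm_add₃_le).trans ?_
    rw [norm_smul, norm_smul, norm_smul, hx]
    have h1 : ‖altCos n j‖ * ‖A‖ ≤ 1 * 2 := by
      gcongr; exact abs_altCos_le n j
    have h2 : ‖altSin n j‖ * ‖B‖ ≤ 1 * b := by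
      gcongr; exact abs_altSin_le n j
    rw [Real.norm_eq_abs t, abs_of_pos ht0]
    linarith
  -- The exact conditions on `y j` hold up to `O(δ)` for the nearby vectors.
  have hdiag : ∀ j < n, ‖gramDiag t (altCos n j) (altSin n j) (gramData (t - t ^ 2) x A B)‖ ≤
      (5 + b) * (K₀ * δ) := by
    intro j hj
    rw [gramDiag_gramData (altCos_sq_add_altSin_sq n j) hx]
    refine (norm_inner_sub_norm_sq_le hx (hxy j) (hR j) (hcl j hj)).trans_eq ?_
    ring
  have hoff : ‖gramOff t (altCos n 0) (altSin n 0) (altCos n 1) (altSin n 1)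
      (gramData (t - t ^ 2) x A B)‖ ≤ (5 + b) * (K₀ * δ) := by
    rw [gramOff_gramData _ hx]
    · refine (norm_inner_le_of_orthogonal (hyy 0) (hy1 0) (hR 1) (hcl 0 (by omega))
        (hcl 1 (by omega))).trans_eq ?_
      ring
    · have := kcbsProb_mul hn3
      rw [← ht] at this
      simp only [altCos, altSin]
      simp
      linear_combination t * this
  have h01 : altCos n 0 = 1 := by simp [altCos]
  have h02 : altSin n 0 = 0 := by simp [altSin]
  have hnorm : ‖gramMap t (altCos n 1) (altSin n 1) (altCos n 2) (altSin n 2)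
      (gramData (t - t ^ 2) x A B)‖ ≤ (5 + b) * (K₀ * δ) := by
    rw [pi_norm_le_iff_of_nonneg (by positivity)]
    have d0 := hdiag 0 (by omega)
    -- Positions `n - k` and `k` have opposite angles.
    have d1 := hdiag (n - 1) (by omega)
    have d2 := hdiag (n - 2) (by omega)
    rw [altCos_sub hodd (by omega), altSin_sub hodd (by omega)] at d1 d2
    rw [h01, h02] at d0 hoff
    intro i
    fin_cases i
    · exact d0
    · exact hdiag 1 (by omega)
    · exact d1
    · exact hdiag 2 (by omega)
    · exact d2
    · exact hoff
  have hanti := ZeroHomClass.bound_of_antilipschitz _ hL (gramData (t - t ^ 2) x A B)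
  calc _ ≤ L * ((5 + b) * (K₀ * δ)) := hanti.trans (by gcongr)
    _ = L * (K₀ * (5 + b)) * δ := by ring
    _ ≤ _ := by
      gcongr
      exact (le_max_right _ _).trans (le_max_right _ _)

end Gram

/-! ### Orthonormal frames near given vectors -/

section Frames

variable {H : Type u} [NormedAddCommGroup H] [InnerProductSpace ℂ H]

/-- One Gram-Schmidt step with an error bound. If the orthogonalized vector vanishes, any unit
vector orthogonal to the given family satisfies the same bound, so no smallness is needed. -/
lemma exists_unit_orthogonal_near {ι : Type*} [Fintype ι] {f : ι → H} (hf : Orthonormal ℂ f)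
    (hex : ∃ e : H, ‖e‖ = 1 ∧ ∀ i, inner ℂ (f i) e = 0) (v : H) {m : ℝ} (hm : m ≠ 0) :
    ∃ e : H, ‖e‖ = 1 ∧ (∀ i, inner ℂ (f i) e = 0) ∧
      ‖(m : ℂ) • e - v‖ ≤ abs (‖v‖ - |m|) + 2 * ∑ i, ‖inner ℂ (f i) v‖ := by
  classical
  set s : H := ∑ i, inner ℂ (f i) v • f i with hs
  have hsn : ‖s‖ ≤ ∑ i, ‖inner ℂ (f i) v‖ := by
    refine (norm_sum_le _ _).trans (Finset.sum_le_sum fun i _ => ?_)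
    rw [norm_smul, hf.1 i, mul_one]
  have horth : ∀ i, inner ℂ (f i) (v - s) = 0 := by
    intro i
    rw [inner_sub_right, hs, hf.inner_right_fintype, sub_self]
  have hm' : 0 < |m| := abs_pos.2 hm
  rcases eq_or_ne (v - s) 0 with h0 | h0
  · obtain ⟨e, he, heo⟩ := hex
    refine ⟨e, he, heo, ?_⟩
    rw [← sub_eq_zero.1 h0] at hsn
    have h1 : ‖(m : ℂ) • e - v‖ ≤ |m| + ‖v‖ := by
      refine (norm_sub_le _ _).trans_eq ?_
      rw [norm_smul, he, Complex.norm_real, Real.norm_eq_abs, mul_one]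
    have h2 := neg_abs_le (‖v‖ - |m|)
    linarith
  · have hpos : 0 < ‖v - s‖ := norm_pos_iff.2 h0
    -- The sign of `m` is absorbed into the unit vector.
    set r : ℝ := |m| / m * ‖v - s‖⁻¹ with hr
    have hmr : m * r = |m| * ‖v - s‖⁻¹ := by rw [hr]; field_simp
    have hrn : |r| = ‖v - s‖⁻¹ := by
      rw [hr, abs_mul, abs_div, abs_abs, div_self hm'.ne', one_mul, abs_of_pos (by positivity)]
    refine ⟨(r : ℂ) • (v - s), ?_, fun i => ?_, ?_⟩
    · rw [norm_smul, Complex.norm_real, Real.norm_eq_abs, hrn, inv_mul_cancel₀ hpos.ne']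
    · rw [inner_smul_right, horth, mul_zero]
    · have e1 : (m : ℂ) • (r : ℂ) • (v - s) - v =
          ((|m| * ‖v - s‖⁻¹ - 1 : ℝ) : ℂ) • (v - s) - s := by
        rw [smul_smul, ← Complex.ofReal_mul, hmr]
        push_cast
        module
      rw [e1]
      refine (norm_sub_le _ _).trans ?_
      rw [norm_smul, Complex.norm_real, Real.norm_eq_abs]
      have e2 : |(|m| * ‖v - s‖⁻¹ - 1)| * ‖v - s‖ = abs (|m| - ‖v - s‖) := by
        rw [← abs_of_pos hpos, ← abs_mul, abs_of_pos hpos]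
        congr 1; field_simp
      rw [e2]
      have h3 : abs (|m| - ‖v - s‖) ≤ abs (‖v‖ - |m|) + ‖s‖ := by
        have h4 : |‖v‖ - ‖v - s‖| ≤ ‖s‖ := by
          simpa using abs_norm_sub_norm_le v (v - s)
        calc abs (|m| - ‖v - s‖) = |(|m| - ‖v‖) + (‖v‖ - ‖v - s‖)| := by congr 1; ring
          _ ≤ abs (|m| - ‖v‖) + |‖v‖ - ‖v - s‖| := abs_add_le _ _
          _ ≤ _ := by rw [abs_sub_comm |m|]; gcongr
      linarith

/-- An odd cycle of consecutively orthogonal unit vectors does not fit into dimension two: there,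
`‖⟪X j, X 0⟫‖ ^ 2` would alternate between `1` and `0`. -/
lemma exists_unit_orthogonal_pair {n : ℕ} (hodd : Odd n) (X : ℕ → H) (hX : ∀ j, ‖X j‖ = 1)
    (hXX : ∀ j, inner ℂ (X j) (X (j + 1)) = 0) (hper : X n = X 0) (a b : H) :
    ∃ e : H, ‖e‖ = 1 ∧ inner ℂ a e = 0 ∧ inner ℂ b e = 0 := by
  classical
  by_contra hcon
  push Not at hcon
  set F : Submodule ℂ H := Submodule.span ℂ {a, b} with hF
  have : FiniteDimensional ℂ F := FiniteDimensional.span_of_finite ℂ (by simp)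
  have hFtop : F = ⊤ := by
    rw [← Submodule.orthogonal_eq_bot_iff, Submodule.eq_bot_iff]
    intro v hv
    by_contra hv0
    have hvn : ‖v‖ ≠ 0 := norm_ne_zero_iff.2 hv0
    have h1 : inner ℂ a v = 0 :=
      (Submodule.mem_orthogonal _ _).1 hv a (Submodule.subset_span (by simp))
    have h2 : inner ℂ b v = 0 :=
      (Submodule.mem_orthogonal _ _).1 hv b (Submodule.subset_span (by simp))
    refine hcon (((‖v‖⁻¹ : ℝ) : ℂ) • v) ?_ ?_ ?_
    · rw [norm_smul, Complex.norm_real, norm_inv, norm_norm, inv_mul_cancel₀ hvn]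
    · rw [inner_smul_right, h1, mul_zero]
    · rw [inner_smul_right, h2, mul_zero]
  have hfr : Module.finrank ℂ H ≤ 2 := by
    rw [← finrank_top ℂ H, ← hFtop, hF]
    refine (finrank_span_le_card (R := ℂ) ({a, b} : Set H)).trans ?_
    rw [Set.toFinset_card, Fintype.card_eq_nat_card]
    exact (Set.ncard_insert_le a {b}).trans (by simp)
  have : FiniteDimensional ℂ H :=
    Module.finite_def.2 (hFtop ▸ Submodule.fg_span (by simp))
  have hon : ∀ j, Orthonormal ℂ ![X j, X (j + 1)] := by
    intro j
    simp [orthonormal_vecCons_iff, hX, hXX]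
  have hsum : ∀ j, ‖inner ℂ (X (j + 1)) (X 0)‖ ^ 2 = 1 - ‖inner ℂ (X j) (X 0)‖ ^ 2 := by
    intro j
    have hcard : Fintype.card (Fin 2) = Module.finrank ℂ H :=
      le_antisymm (hon j).linearIndependent.fintype_card_le_finrank (by simpa using hfr)
    have hB := ((basisOfOrthonormalOfCardEqFinrank (hon j) hcard).toOrthonormalBasis
      (by simpa using hon j)).sum_sq_norm_inner_right (X 0)
    simp [Fin.sum_univ_two, hX] at hB
    linarith
  have halt : ∀ j, ‖inner ℂ (X j) (X 0)‖ ^ 2 = (1 + (-1 : ℝ) ^ j) / 2 := by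
    intro j
    induction j with
    | zero => rw [inner_self_eq_ofReal, hX]; simp
    | succ j ih => rw [hsum, ih, pow_succ]; ring
  have h0 := halt n
  rw [hper, inner_self_eq_ofReal, hX, hodd.neg_one_pow] at h0
  norm_num at h0

lemma abs_norm_sub_abs_le {E : Type*} [SeminormedAddCommGroup E] (v : E) {m G : ℝ} (hm : m ≠ 0)
    (h : |‖v‖ ^ 2 - m ^ 2| ≤ G) : abs (‖v‖ - |m|) ≤ G / |m| := by
  have hm' : 0 < |m| := abs_pos.2 hm
  rw [le_div_iff₀ hm']
  calc abs (‖v‖ - |m|) * |m| ≤ abs (‖v‖ - |m|) * abs (‖v‖ + |m|) := by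
        refine mul_le_mul_of_nonneg_left (le_trans ?_ (le_abs_self _)) (abs_nonneg _)
        linarith [norm_nonneg v]
    _ = |‖v‖ ^ 2 - m ^ 2| := by
        rw [← abs_mul, ← sq_abs m]; congr 1; ring
    _ ≤ G := h

/-- Vectors with nearly the optimal Gram data are near an exactly orthogonal frame. -/
lemma exists_orthonormal_near {x A B : H} (hx : ‖x‖ = 1)
    (hdim : ∀ a b : H, ∃ e : H, ‖e‖ = 1 ∧ inner ℂ a e = 0 ∧ inner ℂ b e = 0)
    {m G K : ℝ} (hm : m ≠ 0) (hG : ‖gramData (m ^ 2) x A B‖ ≤ G) (hB : ‖B‖ ≤ K) :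
    ∃ e₁ e₂ : H, Orthonormal ℂ ![x, e₁, e₂] ∧ ‖(m : ℂ) • e₂ - A‖ ≤ (1 / |m| + 2) * G ∧
      ‖(m : ℂ) • e₁ + B‖ ≤ (1 / |m| + 2 + 2 * ((1 / |m| + 2) * K + 1) / |m|) * G := by
  have hm' : 0 < |m| := abs_pos.2 hm
  have hG0 : 0 ≤ G := (norm_nonneg _).trans hG
  simp only [gramData, Prod.norm_def, max_le_iff, Real.norm_eq_abs] at hG
  obtain ⟨hα, hβ, hκ, ha, hb⟩ := hG
  have hon1 : Orthonormal ℂ ![x] := by simp [hx]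
  obtain ⟨e₂, he₂, ho₂, hn₂⟩ := exists_unit_orthogonal_near hon1
    (by obtain ⟨e, h1, h2, -⟩ := hdim x x; exact ⟨e, h1, by simpa using h2⟩) A hm
  have ho₂' : inner ℂ x e₂ = 0 := by simpa using ho₂ 0
  have hon2 : Orthonormal ℂ ![x, e₂] := by simp [orthonormal_vecCons_iff, hx, he₂, ho₂']
  obtain ⟨e₁, he₁, ho₁, hn₁⟩ := exists_unit_orthogonal_near hon2
    (by
      obtain ⟨e, h1, h2, h3⟩ := hdim x e₂
      exact ⟨e, h1, by simpa [Fin.forall_fin_two] using ⟨h2, h3⟩⟩) (-B) hm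
  have ho₁' : inner ℂ x e₁ = 0 := by simpa using ho₁ 0
  have ho₁'' : inner ℂ e₂ e₁ = 0 := by simpa using ho₁ 1
  have hA2 : ‖(m : ℂ) • e₂ - A‖ ≤ (1 / |m| + 2) * G := by
    refine hn₂.trans ?_
    have := abs_norm_sub_abs_le A hm ha
    simp only [Matrix.cons_val_zero, Finset.univ_unique, Fin.default_eq_zero,
      Finset.sum_singleton]
    calc _ ≤ G / |m| + 2 * G := by gcongr
      _ = _ := by ring
  refine ⟨e₁, e₂, ?_, hA2, ?_⟩
  · have h12 : inner ℂ e₁ e₂ = 0 := by rw [← inner_conj_symm, ho₁'', map_zero]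
    simp [orthonormal_vecCons_iff, hx, he₁, he₂, ho₂', ho₁', h12, Fin.forall_fin_two]
  · have h2 : ‖inner ℂ e₂ B‖ ≤ ((1 / |m| + 2) * K + 1) / |m| * G := by
      have e : (m : ℂ) * inner ℂ e₂ B = inner ℂ ((m : ℂ) • e₂ - A) B + inner ℂ A B := by
        rw [inner_sub_left, inner_smul_left]; simp
      have e' : |m| * ‖inner ℂ e₂ B‖ ≤ (1 / |m| + 2) * G * K + G := by
        have e2 : |m| * ‖inner ℂ e₂ B‖ = ‖(m : ℂ) * inner ℂ e₂ B‖ := by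
          rw [norm_mul, Complex.norm_real, Real.norm_eq_abs]
        rw [e2, e]
        refine (norm_add_le _ _).trans ?_
        have : ‖inner ℂ ((m : ℂ) • e₂ - A) B‖ ≤ (1 / |m| + 2) * G * K :=
          (norm_inner_le_norm _ _).trans (by gcongr)
        gcongr
      rw [div_mul_eq_mul_div, le_div_iff₀ hm']
      linarith
    have h3 := abs_norm_sub_abs_le (-B) (G := G) hm (by rwa [norm_neg])
    rw [sub_neg_eq_add] at hn₁
    refine hn₁.trans ?_
    simp only [Fin.sum_univ_two, Matrix.cons_val_zero, Matrix.cons_val_one, inner_neg_right,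
      norm_neg] at h3 ⊢
    calc _ ≤ G / |m| + 2 * (G + ((1 / |m| + 2) * K + 1) / |m| * G) := by gcongr
      _ = _ := by ring

lemma exists_isometry_of_orthonormal {e₀ e₁ e₂ : H} (h : Orthonormal ℂ ![e₀, e₁, e₂]) :
    ∃ V : EuclideanSpace ℂ (Fin 3) →ₗᵢ[ℂ] H, ∀ u, V u = u 0 • e₀ + u 1 • e₁ + u 2 • e₂ := by
  let b := EuclideanSpace.basisFun (Fin 3) ℂ
  let f : EuclideanSpace ℂ (Fin 3) →ₗ[ℂ] H := b.toBasis.constr ℂ ![e₀, e₁, e₂]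
  have hfb : f ∘ b.toBasis = ![e₀, e₁, e₂] := by
    funext i; simp [f]
  refine ⟨f.isometryOfOrthonormal (v := b.toBasis) (by simp)
    (by rw [hfb]; exact h), fun u => ?_⟩
  change f u = _
  simp [f, Module.Basis.constr_apply_fintype, Fin.sum_univ_three, b]

end Frames

/-! ### Rank-one projectors -/

section Projectors

variable {H : Type u} [NormedAddCommGroup H] [InnerProductSpace ℂ H]

lemma proj_smul (a : ℂ) (x : H) : proj (a • x) = ((‖a‖ ^ 2 : ℝ) : ℂ) • proj x := by
  ext z
  simp only [proj, InnerProductSpace.rankOne_apply, inner_smul_left, smul_apply,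
    smul_smul]
  congr 1
  have : (starRingEnd ℂ) a * a = ((‖a‖ ^ 2 : ℝ) : ℂ) := by
    rw [Complex.conj_mul']; push_cast; rfl
  rw [← this]; ring

lemma norm_proj_sub_proj_le (p q : H) : ‖proj p - proj q‖ ≤ ‖p - q‖ * (‖p‖ + ‖q‖) := by
  have e : proj p - proj q =
      InnerProductSpace.rankOne ℂ (p - q) p + InnerProductSpace.rankOne ℂ q (p - q) := by
    ext z
    simp only [proj, sub_apply, add_apply,
      InnerProductSpace.rankOne_apply, inner_sub_left]
    module
  rw [e]
  refine (norm_add_le _ _).trans_eq ?_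
  rw [InnerProductSpace.norm_rankOne, InnerProductSpace.norm_rankOne]; ring

/-- Passing from the projections of the state to the projectors themselves. -/
lemma norm_proj_sub_proj_le_of_near {x ψ w : H} (hx : ‖x‖ = 1) (hψ : ‖ψ‖ = 1) (hw : ‖w‖ = 1)
    {k η : ℝ} (hk : k ≠ 0) (hk1 : |k| ≤ 1) (hη : ‖inner ℂ x ψ • x - (k : ℂ) • w‖ ≤ η) :
    ‖proj w - proj x‖ ≤ 4 / k ^ 2 * η := by
  have hk2 : 0 < k ^ 2 := by positivity
  set y := inner ℂ x ψ • x with hy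
  have hη0 : 0 ≤ η := (norm_nonneg _).trans hη
  have hyn : ‖y‖ = ‖inner ℂ x ψ‖ := by rw [hy, norm_smul, hx, mul_one]
  have hy1 : ‖y‖ ≤ 1 := by
    rw [hyn]; refine (norm_inner_le_norm _ _).trans ?_; rw [hx, hψ, one_mul]
  have hkw : ‖(k : ℂ) • w‖ = |k| := by
    rw [norm_smul, hw, mul_one, Complex.norm_real, Real.norm_eq_abs]
  have e : ((k ^ 2 : ℝ) : ℂ) • (proj w - proj x) =
      (proj ((k : ℂ) • w) - proj y) + ((‖y‖ ^ 2 - k ^ 2 : ℝ) : ℂ) • proj x := by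
    rw [hyn, hy, proj_smul, proj_smul, Complex.norm_real, Real.norm_eq_abs, sq_abs]
    push_cast
    module
  have h1 : ‖proj ((k : ℂ) • w) - proj y‖ ≤ η * 2 := by
    refine (norm_proj_sub_proj_le _ _).trans ?_
    rw [norm_sub_rev, hkw]
    gcongr; linarith
  have h2 : ‖((‖y‖ ^ 2 - k ^ 2 : ℝ) : ℂ) • proj x‖ ≤ η * 2 := by
    rw [norm_smul, proj, InnerProductSpace.norm_rankOne, hx, mul_one, mul_one, Complex.norm_real,
      Real.norm_eq_abs, ← sq_abs k, ← hkw, sq_sub_sq, abs_mul, mul_comm]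
    have h3 : |‖y‖ - ‖(k : ℂ) • w‖| ≤ η := (abs_norm_sub_norm_le _ _).trans hη
    have h4 : |‖y‖ + ‖(k : ℂ) • w‖| ≤ 2 := by
      rw [abs_of_nonneg (by positivity), hkw]; linarith
    gcongr
  have h5 : k ^ 2 * ‖proj w - proj x‖ ≤ 4 * η := by
    have := congrArg norm e
    rw [norm_smul, Complex.norm_real, Real.norm_eq_abs, abs_of_pos hk2] at this
    rw [this]
    refine (norm_add_le _ _).trans ?_
    linarith
  rw [div_mul_eq_mul_div, le_div_iff₀ hk2]
  linarith

lemma conj_proj {K : Type v} [NormedAddCommGroup K] [InnerProductSpace ℂ K] [CompleteSpace K]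
    [CompleteSpace H] (V : K →ₗᵢ[ℂ] H) (x : K) : conj V (proj x) = proj (V x) := by
  ext z
  simp [conj, proj, ContinuousLinearMap.adjoint_inner_right]

end Projectors

/-! ### Cyclic indexing and the optimal vectors -/

section Cycle

lemma cos_nat_mul_pi_sub (j : ℕ) (a : ℝ) :
    Real.cos (j * Real.pi - a) = (-1) ^ j * Real.cos a := by
  rw [Real.cos_sub, Real.cos_nat_mul_pi, Real.sin_nat_mul_pi]; ring

lemma sin_nat_mul_pi_sub (j : ℕ) (a : ℝ) :
    Real.sin (j * Real.pi - a) = -((-1) ^ j * Real.sin a) := by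
  rw [Real.sin_sub, Real.cos_nat_mul_pi, Real.sin_nat_mul_pi]; ring

lemma altCos_self {n : ℕ} (hodd : Odd n) : altCos n n = altCos n 0 := by
  simpa using (altCos_sub hodd le_rfl).symm

lemma altSin_self {n : ℕ} (hodd : Odd n) : altSin n n = altSin n 0 := by
  have h0 : altSin n 0 = 0 := by simp [altSin]
  have := altSin_sub hodd (le_refl n)
  rw [Nat.sub_self] at this
  linarith

/-- The vertices of the `n`-cycle in cyclic order, indexed by `ℕ` so that position `j` carries the
event numbered `j` for `1 ≤ j ≤ n`, and position `0` is position `n`. -/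
def cycleVertex (n : ℕ) [NeZero n] (j : ℕ) : Fin n := Fin.ofNat n (j + (n - 1))

variable {n : ℕ} [NeZero n]

lemma cycleVertex_add_one (i : Fin n) : cycleVertex n (i + 1) = i := by
  have := i.2
  apply Fin.ext
  simp only [cycleVertex, Fin.ofNat]
  rw [show (i : ℕ) + 1 + (n - 1) = i + n by omega, Nat.add_mod_right, Nat.mod_eq_of_lt this]

lemma cycleVertex_self : cycleVertex n n = cycleVertex n 0 := by
  apply Fin.ext
  simp [cycleVertex, Fin.ofNat]

lemma cycleVertex_surjective (i : Fin n) : ∃ j < n, cycleVertex n j = i := by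
  rcases Nat.lt_or_ge (i + 1) n with h | h
  · exact ⟨i + 1, h, cycleVertex_add_one i⟩
  · refine ⟨0, i.pos, ?_⟩
    rw [← cycleVertex_self, ← cycleVertex_add_one i, show (i : ℕ) + 1 = n by omega]

lemma adj_cycleVertex (hn : 2 ≤ n) (j : ℕ) :
    (SimpleGraph.cycleGraph n).Adj (cycleVertex n j) (cycleVertex n (j + 1)) := by
  rw [SimpleGraph.cycleGraph_adj']
  right
  simp only [cycleVertex, Fin.ofNat, Fin.sub_def]
  rw [show j + 1 + (n - 1) = (j + (n - 1)) + 1 by omega]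
  generalize j + (n - 1) = k
  have hk : k % n < n := Nat.mod_lt _ (by omega)
  rw [Nat.add_mod k 1 n, Nat.mod_eq_of_lt (show 1 < n by omega), Nat.add_mod_mod,
    show n - k % n + (k % n + 1) = n + 1 by omega, Nat.add_mod_left,
    Nat.mod_eq_of_lt (show 1 < n by omega)]

lemma sum_range_cycleVertex (f : Fin n → ℝ) :
    ∑ j ∈ Finset.range n, f (cycleVertex n j) = ∑ i, f i := by
  have h := Finset.sum_range_succ' (fun j => f (cycleVertex n j)) n
  rw [Finset.sum_range_succ, cycleVertex_self, add_right_cancel_iff] at h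
  rw [h, Finset.sum_range]
  simp only [cycleVertex_add_one]

/-- Consecutive vertices on the `n`-cycle are the only adjacent ones. -/
lemma exists_cycleVertex_of_adj {i j : Fin n} (h : (SimpleGraph.cycleGraph n).Adj i j) :
    ∃ k < n, (i = cycleVertex n k ∧ j = cycleVertex n (k + 1)) ∨
      (j = cycleVertex n k ∧ i = cycleVertex n (k + 1)) := by
  have aux : ∀ i j : Fin n, ((j - i : Fin n) : ℕ) = 1 →
      ∃ k < n, i = cycleVertex n k ∧ j = cycleVertex n (k + 1) := by
    intro i j h1
    obtain ⟨k, hk, rfl⟩ := cycleVertex_surjective i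
    refine ⟨k, hk, rfl, ?_⟩
    have h2 : (j - cycleVertex n k) = cycleVertex n (k + 1) - cycleVertex n k := by
      apply Fin.ext
      rw [h1]
      have hn : 2 ≤ n := by
        have := (j - cycleVertex n k).2
        omega
      simp only [cycleVertex, Fin.ofNat, Fin.sub_def]
      rw [show k + 1 + (n - 1) = (k + (n - 1)) + 1 by omega]
      generalize k + (n - 1) = l
      have hk : l % n < n := Nat.mod_lt _ (by omega)
      rw [Nat.add_mod l 1 n, Nat.mod_eq_of_lt (show 1 < n by omega), Nat.add_mod_mod,
        show n - l % n + (l % n + 1) = n + 1 by omega, Nat.add_mod_left,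
        Nat.mod_eq_of_lt (show 1 < n by omega)]
    exact sub_left_injective h2
  rw [SimpleGraph.cycleGraph_adj'] at h
  rcases h with h | h
  · obtain ⟨k, hk, h1, h2⟩ := aux j i h
    exact ⟨k, hk, Or.inr ⟨h1, h2⟩⟩
  · obtain ⟨k, hk, h1, h2⟩ := aux i j h
    exact ⟨k, hk, Or.inl ⟨h1, h2⟩⟩

lemma kcbsVectors_succ (θ : ℝ) (i : Fin n) :
    kcbsVectors n θ i.succ = !₂[((Real.cos θ : ℝ) : ℂ),
      ((-(Real.sin θ * altSin n (i + 1)) : ℝ) : ℂ),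
      ((Real.sin θ * altCos n (i + 1) : ℝ) : ℂ)] := by
  have hn : (n : ℝ) ≠ 0 := by exact_mod_cast NeZero.ne n
  have hφ : ((i.succ : ℕ) : ℝ) * Real.pi * ((n : ℝ) - 1) / n =
      (i + 1 : ℕ) * Real.pi - (i + 1 : ℕ) * (Real.pi / n) := by
    rw [Fin.val_succ]; field_simp
  simp only [kcbsVectors, Fin.succ_ne_zero, if_false, hφ]
  rw [cos_nat_mul_pi_sub, sin_nat_mul_pi_sub]
  simp only [altCos, altSin, mul_neg]

/-- The formula holds for `j = 0` as well: as `n` is odd, `φ_n` is a multiple of `2 π`. -/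
lemma kcbsVectors_cycleVertex (hodd : Odd n) (θ : ℝ) {j : ℕ} (hj : j ≤ n) :
    kcbsVectors n θ (cycleVertex n j).succ = !₂[((Real.cos θ : ℝ) : ℂ),
      ((-(Real.sin θ * altSin n j) : ℝ) : ℂ), ((Real.sin θ * altCos n j : ℝ) : ℂ)] := by
  have key : ∀ j < n, kcbsVectors n θ (cycleVertex n (j + 1)).succ = !₂[((Real.cos θ : ℝ) : ℂ),
      ((-(Real.sin θ * altSin n (j + 1)) : ℝ) : ℂ),
      ((Real.sin θ * altCos n (j + 1) : ℝ) : ℂ)] := by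
    intro j hj
    rw [show cycleVertex n (j + 1) = ⟨j, hj⟩ from cycleVertex_add_one ⟨j, hj⟩, kcbsVectors_succ]
  rcases j with _ | j
  · have h := key (n - 1) (by have := NeZero.pos n; omega)
    rw [Nat.sub_add_cancel (NeZero.pos n), altCos_self hodd, altSin_self hodd,
      cycleVertex_self] at h
    exact h
  · exact key j hj

end Cycle

/-! ### Closeness of realizations up to isometry -/

section Stability

lemma value_one_behavior {n : ℕ} {H : Type*} [NormedAddCommGroup H] [InnerProductSpace ℂ H]
    (x : Fin (n + 1) → H) :
    value (fun _ => 1) (behavior x) = ∑ i : Fin n, ‖inner ℂ (x i.succ) (x 0)‖ ^ 2 := by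
  simp only [value, behavior, one_mul, norm_inner_symm (x 0)]

/-- Every realization is as close to the optimal one as the square root of its gap to the quantum
bound, up to an isometry. There is no restriction on the gap, so this contains both the
self-test and its robustness. -/
lemma exists_isometry_near {n : ℕ} (hodd : Odd n) (hn : 5 ≤ n) {θ : ℝ}
    (hθ : Real.cos θ ^ 2 = kcbsProb n) :
    ∃ C : ℝ, 0 ≤ C ∧ ∀ (H : Type u) [NormedAddCommGroup H] [InnerProductSpace ℂ H]
      [CompleteSpace H] (x : Fin (n + 1) → H), IsRealization (SimpleGraph.cycleGraph n) x →
      ∃ V : EuclideanSpace ℂ (Fin 3) →ₗᵢ[ℂ] H, ∀ i,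
        ‖conj V (proj (kcbsVectors n θ i)) - proj (x i)‖ ≤
          C * √(n * kcbsProb n - value (fun _ => 1) (behavior x)) := by
  have : NeZero n := ⟨by omega⟩
  have hn3 : 3 ≤ n := by omega
  obtain ⟨K, hK, hstab⟩ := exists_gram_stability.{u} hodd hn
  have ht0 := kcbsProb_pos hn3
  have ht1 := kcbsProb_lt_half hn3
  set t := kcbsProb n with ht
  have hs2 : Real.sin θ ^ 2 = 1 - t := by rw [← hθ]; exact Real.sin_sq θ
  have hcos : Real.cos θ ≠ 0 := fun h => by rw [h] at hθ; norm_num at hθ; linarith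
  have hsin : Real.sin θ ≠ 0 := fun h => by rw [h] at hs2; norm_num at hs2; linarith
  obtain ⟨m, hm⟩ : ∃ m, m = Real.cos θ * Real.sin θ := ⟨_, rfl⟩
  have hm0 : m ≠ 0 := hm ▸ mul_ne_zero hcos hsin
  have hm2 : m ^ 2 = t - t ^ 2 := by rw [hm, mul_pow, hθ, hs2]; ring
  obtain ⟨c₂, hc₂⟩ : ∃ c, c = 1 / |m| + 2 := ⟨_, rfl⟩
  obtain ⟨c₁, hc₁⟩ : ∃ c, c = 1 / |m| + 2 + 2 * ((1 / |m| + 2) * K + 1) / |m| := ⟨_, rfl⟩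
  have hc₂0 : 0 ≤ c₂ := by rw [hc₂]; positivity
  have hc₁0 : 0 ≤ c₁ := by rw [hc₁]; positivity
  refine ⟨4 / t * (K + c₂ * K + c₁ * K), by positivity, ?_⟩
  intro H _ _ _ x hx
  set X : ℕ → H := fun j => x (cycleVertex n j).succ with hX
  have hX1 : ∀ j, ‖X j‖ = 1 := fun j => hx.norm_eq_one _
  have hXX : ∀ j, inner ℂ (X j) (X (j + 1)) = 0 :=
    fun j => hx.excl _ _ (adj_cycleVertex (by omega) j)
  have hXn : X n = X 0 := by simp only [X, cycleVertex_self]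
  have hψ : ‖x 0‖ = 1 := hx.norm_eq_one 0
  have hYn : ∀ j, ‖inner ℂ (X j) (x 0) • X j‖ = ‖inner ℂ (X j) (x 0)‖ := fun j => by
    rw [norm_smul, hX1, mul_one]
  obtain ⟨A, B, hBK, hclose, hgram⟩ := hstab H (x 0) (fun j => inner ℂ (X j) (x 0) • X j) hψ
    (fun j => by
      rw [hYn, inner_smul_right, ← inner_conj_symm (x 0) (X j), Complex.mul_conj']
      push_cast; rfl)
    (fun j => by rw [inner_smul_left, inner_smul_right, hXX, mul_zero, mul_zero])
    (by simp only [hXn])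
  have hval : ∑ j ∈ Finset.range n, ‖inner ℂ (X j) (x 0) • X j‖ ^ 2 =
      value (fun _ => 1) (behavior x) := by
    simp only [hYn]
    rw [value_one_behavior, ← sum_range_cycleVertex]
  rw [hval] at hclose hgram
  have hδ := Real.sqrt_nonneg (n * t - value (fun _ => 1) (behavior x))
  generalize √(n * t - value (fun _ => 1) (behavior x)) = δ at hδ hclose hgram ⊢
  rw [← hm2] at hgram
  obtain ⟨e₁, e₂, hon, h₂, h₁⟩ := exists_orthonormal_near hψ
    (exists_unit_orthogonal_pair hodd X hX1 hXX hXn) hm0 hgram hBK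
  rw [← hc₂] at h₂
  rw [← hc₁] at h₁
  obtain ⟨V, hV⟩ := exists_isometry_of_orthonormal hon
  refine ⟨V, fun i => ?_⟩
  rw [conj_proj]
  refine Fin.cases ?_ (fun i => ?_) i
  · have : V (kcbsVectors n θ 0) = x 0 := by simp [hV, kcbsVectors]
    rw [this, sub_self, norm_zero]
    positivity
  · obtain ⟨j, hj, rfl⟩ := cycleVertex_surjective i
    have hu := kcbsVectors_cycleVertex hodd θ hj.le
    -- `cos θ • u j` has first coordinate `t`, like the projection of the state onto `u j`.
    have hVu : (Real.cos θ : ℂ) • V (kcbsVectors n θ (cycleVertex n j).succ) =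
        t • x 0 - altSin n j • (m : ℂ) • e₁ + altCos n j • (m : ℂ) • e₂ := by
      rw [hV, hu, hm, ← hθ]
      simp only [← Complex.coe_smul, Matrix.cons_val]
      push_cast
      module
    have hVn : ‖V (kcbsVectors n θ (cycleVertex n j).succ)‖ = 1 := by
      have h3 : (Real.cos θ : ℂ) ≠ 0 := by exact_mod_cast hcos
      rw [V.norm_map, hu, EuclideanSpace.norm_eq, Real.sqrt_eq_one, Fin.sum_univ_three]
      simp only [Matrix.cons_val, Complex.norm_real, Real.norm_eq_abs, sq_abs]
      linear_combination Real.sin_sq_add_cos_sq θ +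
        Real.sin θ ^ 2 * altCos_sq_add_altSin_sq n j
    have hnear : ‖inner ℂ (X j) (x 0) • X j -
        (Real.cos θ : ℂ) • V (kcbsVectors n θ (cycleVertex n j).succ)‖ ≤
        (K + c₂ * K + c₁ * K) * δ := by
      have e : inner ℂ (X j) (x 0) • X j -
          (Real.cos θ : ℂ) • V (kcbsVectors n θ (cycleVertex n j).succ) =
          (inner ℂ (X j) (x 0) • X j - (t • x 0 + altCos n j • A + altSin n j • B)) -
            altCos n j • ((m : ℂ) • e₂ - A) + altSin n j • ((m : ℂ) • e₁ + B) := by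
        rw [hVu]; module
      rw [e]
      refine (norm_add_le _ _).trans ((add_le_add_left (norm_sub_le _ _) _).trans ?_)
      rw [norm_smul, norm_smul]
      have b2 : ‖altCos n j‖ * ‖(m : ℂ) • e₂ - A‖ ≤ 1 * (c₂ * (K * δ)) := by
        gcongr; exact abs_altCos_le n j
      have b1 : ‖altSin n j‖ * ‖(m : ℂ) • e₁ + B‖ ≤ 1 * (c₁ * (K * δ)) := by
        gcongr; exact abs_altSin_le n j
      have b0 := hclose j hj
      linarith
    refine (norm_proj_sub_proj_le_of_near (hX1 j) hψ hVn hcos (Real.abs_cos_le_one θ)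
      hnear).trans_eq ?_
    rw [hθ]; ring

end Stability

/-! ### Traces in infinite dimension -/

section Trace

variable {H : Type u} [NormedAddCommGroup H] [InnerProductSpace ℂ H]

lemma hasSum_of_forall_eq {ι α : Type*} [AddCommMonoid α] [TopologicalSpace α] {f g : ι → α} {a : α}
    (h : HasSum g a) (e : ∀ k, f k = g k) : HasSum f a := by
  rwa [funext e]

lemma hasSum_norm_inner_sq {ι : Type*} (b : HilbertBasis ι ℂ H) (x : H) :
    HasSum (fun k => ‖inner ℂ (b k) x‖ ^ 2) (‖x‖ ^ 2) := by
  have h := b.hasSum_inner_mul_inner x x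
  rw [inner_self_eq_ofReal] at h
  rw [← Complex.hasSum_ofReal]
  refine hasSum_of_forall_eq h fun k => ?_
  rw [← inner_conj_symm x (b k), Complex.conj_mul']
  push_cast; rfl

lemma tsum_ofReal_norm_inner_sq {ι : Type*} (b : HilbertBasis ι ℂ H) (x : H) :
    ∑' k, ENNReal.ofReal (‖inner ℂ (b k) x‖ ^ 2) = ENNReal.ofReal (‖x‖ ^ 2) := by
  have h := hasSum_norm_inner_sq b x
  rw [← ENNReal.ofReal_tsum_of_nonneg (fun _ => by positivity) h.summable, h.tsum_eq]

lemma eq_zero_of_inner_hilbertBasis {ι : Type*} (b : HilbertBasis ι ℂ H) {x : H}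
    (h : ∀ k, inner ℂ (b k) x = 0) : x = 0 := by
  have h1 := hasSum_norm_inner_sq b x
  simp only [h, norm_zero, ne_eq, OfNat.ofNat_ne_zero, not_false_eq_true, zero_pow] at h1
  have h2 := h1.unique hasSum_zero
  simpa using h2

variable [CompleteSpace H]

/-- The Hilbert-Schmidt norm is the same for an operator and its adjoint, and does not depend on
the basis. -/
lemma tsum_norm_sq_eq_tsum_adjoint {ι κ : Type*} (b : HilbertBasis ι ℂ H) (c : HilbertBasis κ ℂ H)
    (T : H →L[ℂ] H) :
    ∑' k, ENNReal.ofReal (‖T (b k)‖ ^ 2) =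
      ∑' l, ENNReal.ofReal (‖ContinuousLinearMap.adjoint T (c l)‖ ^ 2) := by
  simp only [← tsum_ofReal_norm_inner_sq c (T _), ← tsum_ofReal_norm_inner_sq b]
  rw [ENNReal.tsum_comm]
  simp only [ContinuousLinearMap.adjoint_inner_right, norm_inner_symm (c _)]

/-- A Hilbert basis adapted to the range and kernel of a projection. -/
lemma exists_adapted_hilbertBasis {P : H →L[ℂ] H} (hP : IsStarProjection P) :
    ∃ (ι : Type u) (b : HilbertBasis ι ℂ H), ∀ k, P (b k) = b k ∨ P (b k) = 0 := by
  have hPP : ∀ v, P (P v) = P v := fun v => congrArg (fun T : H →L[ℂ] H => T v) hP.1.eq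
  have hPs : ∀ v w, inner ℂ (P v) w = inner ℂ v (P w) := fun v w => by
    rw [← ContinuousLinearMap.adjoint_inner_right, hP.2.adjoint_eq]
  let F : Submodule ℂ H := (ContinuousLinearMap.id ℂ H - P).ker
  have hF : ∀ v, v ∈ F ↔ P v = v := fun v => by
    simp [F, sub_eq_zero, eq_comm (a := v)]
  have hFc : IsClosed (F : Set H) := (ContinuousLinearMap.id ℂ H - P).isClosed_ker
  have : CompleteSpace F := hFc.completeSpace_coe
  -- Extend a Hilbert basis of the range; the added vectors lie in the kernel.
  obtain ⟨w, c, -⟩ := exists_hilbertBasis ℂ F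
  have hon : Orthonormal ℂ (fun k : w => ((c k : F) : H)) :=
    c.orthonormal.comp_linearIsometry F.subtypeₗᵢ
  obtain ⟨w', b, hw, hb⟩ := hon.toSubtypeRange.exists_hilbertBasis_extension
  refine ⟨w', b, fun k => ?_⟩
  by_cases hk : b k ∈ Set.range (fun k : w => ((c k : F) : H))
  · obtain ⟨l, hl⟩ := hk
    left
    rw [← hl]
    exact (hF _).1 (c l).2
  · right
    have hPF : P (b k) ∈ F := (hF _).2 (hPP _)
    have h0 : (⟨P (b k), hPF⟩ : F) = 0 := by
      refine eq_zero_of_inner_hilbertBasis c fun l => ?_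
      rw [Submodule.coe_inner]
      change inner ℂ ((c l : F) : H) (P (b k)) = 0
      rw [← hPs, (hF _).1 (c l).2]
      have hmem : ((c l : F) : H) ∈ w' := hw ⟨l, rfl⟩
      have hbl : b ⟨_, hmem⟩ = ((c l : F) : H) := by rw [hb]
      rw [← hbl]
      refine b.orthonormal.2 fun h => hk ?_
      rw [← h, hbl]
      exact ⟨l, rfl⟩
    exact congrArg Subtype.val h0

/-- The trace of `S† S P` as a basis-independent sum of squares. -/
lemma HasTrace.tsum_norm_sq_eq {P S : H →L[ℂ] H} (hP : IsStarProjection P) {p : ℝ}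
    (h : HasTrace ((star S * S) ∘L P) (p : ℂ)) {κ : Type*} (c : HilbertBasis κ ℂ H) :
    ∑' l, ENNReal.ofReal (‖P (ContinuousLinearMap.adjoint S (c l))‖ ^ 2) = ENNReal.ofReal p := by
  obtain ⟨ι, b, hb⟩ := exists_adapted_hilbertBasis hP
  -- In an adapted basis every diagonal entry of `S† S P` is a square.
  have h1 : HasSum (fun k => ‖(S ∘L P) (b k)‖ ^ 2) p := by
    rw [← Complex.hasSum_ofReal]
    refine hasSum_of_forall_eq (h ι b) fun k => ?_
    rw [← inner_self_eq_ofReal]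
    change inner ℂ (S (P (b k))) (S (P (b k))) =
      inner ℂ (b k) (ContinuousLinearMap.adjoint S (S (P (b k))))
    rw [ContinuousLinearMap.adjoint_inner_right]
    rcases hb k with hk | hk <;> rw [hk]
    simp
  have h2 := tsum_norm_sq_eq_tsum_adjoint b c (S ∘L P)
  rw [← ENNReal.ofReal_tsum_of_nonneg (fun _ => by positivity) h1.summable, h1.tsum_eq,
    ContinuousLinearMap.adjoint_comp, hP.2.adjoint_eq] at h2
  exact h2.symm

/-- Two projections whose product has trace zero have orthogonal ranges. -/
lemma HasTrace.inner_eq_zero {P Q : H →L[ℂ] H} (hP : IsStarProjection P) (hQ : IsStarProjection Q)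
    (h : HasTrace (P ∘L Q) 0) (v : H) : inner ℂ (P v) (Q v) = 0 := by
  have hPs : ∀ v w, inner ℂ (P v) w = inner ℂ v (P w) := fun v w => by
    rw [← ContinuousLinearMap.adjoint_inner_right, hP.2.adjoint_eq]
  have hQs : ∀ v w, inner ℂ (Q v) w = inner ℂ v (Q w) := fun v w => by
    rw [← ContinuousLinearMap.adjoint_inner_right, hQ.2.adjoint_eq]
  have hQQ : ∀ v, Q (Q v) = Q v := fun v => congrArg (fun T : H →L[ℂ] H => T v) hQ.1.eq
  obtain ⟨ι, b, hb⟩ := exists_adapted_hilbertBasis hP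
  have h1 : HasSum (fun k => ‖Q (P (b k))‖ ^ 2) 0 := by
    rw [← Complex.hasSum_ofReal, Complex.ofReal_zero]
    refine hasSum_of_forall_eq (h ι b) fun k => ?_
    rw [← inner_self_eq_ofReal, hQs, hQQ, ContinuousLinearMap.comp_apply, ← hPs]
    rcases hb k with hk | hk <;> rw [hk]
    simp
  have h2 : ∀ k, Q (P (b k)) = 0 := fun k => by
    have h3 := (hasSum_zero_iff_of_nonneg (fun k => sq_nonneg ‖Q (P (b k))‖)).1 h1
    simpa using congrFun h3 k
  have h4 : P (Q v) = 0 := eq_zero_of_inner_hilbertBasis b fun k => by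
    rw [← hPs, ← hQs, h2, inner_zero_left]
  rw [hPs, h4, inner_zero_right]

end Trace

/-! ### The quantum bound -/

section QuantumBound

/-- The quantum bound holds for all density operators and projectors, in any dimension: for
`ρ = S† S`, the value is a sum over a Hilbert basis of the values of the unnormalized pure states
`S† c l`. -/
lemma value_le_of_mem_quantumBehaviors {n : ℕ} (hodd : Odd n) (hn : 3 ≤ n) {p : Fin n → ℝ}
    (hp : p ∈ quantumBehaviors.{u} (SimpleGraph.cycleGraph n)) :
    value (fun _ => 1) p ≤ n * kcbsProb n := by
  obtain ⟨⟨hbeh, -⟩, H, _, _, _, ρ, P, hR⟩ := hp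
  have : NeZero n := ⟨by omega⟩
  have ht := kcbsProb_pos hn
  obtain ⟨S, rfl⟩ := CStarAlgebra.nonneg_iff_eq_star_mul_self.1
    ((ContinuousLinearMap.nonneg_iff_isPositive ρ).2 hR.state_pos)
  obtain ⟨w, c, -⟩ := exists_hilbertBasis ℂ H
  have hid : IsStarProjection (ContinuousLinearMap.id ℂ H) := .one _
  -- The trace of `ρ` itself is the case of the identity projection.
  have htr := HasTrace.tsum_norm_sq_eq (S := S) (p := 1) hid
    (by simpa using hR.state_trace) c
  have hprob := fun i => HasTrace.tsum_norm_sq_eq (hR.proj i) (hR.prob i) c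
  have hpure : ∀ v : H, ∑ i, ‖P i v‖ ^ 2 ≤ n * kcbsProb n * ‖v‖ ^ 2 := by
    intro v
    let _ : InnerProductSpace ℝ H := InnerProductSpace.complexToReal
    have h := sum_norm_sq_le hodd hn v (fun j => P (cycleVertex n j) v)
      (fun j => by
        have hPj := hR.proj (cycleVertex n j)
        have hPP : P (cycleVertex n j) (P (cycleVertex n j) v) = P (cycleVertex n j) v :=
          congrArg (fun T : H →L[ℂ] H => T v) hPj.1.eq
        rw [real_inner_eq_re_inner ℂ]
        nth_rw 1 [← hPP]
        rw [← ContinuousLinearMap.adjoint_inner_left, hPj.2.adjoint_eq, inner_self_eq_ofReal]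
        exact Complex.ofReal_re _)
      (fun j => by
        rw [real_inner_eq_re_inner ℂ, HasTrace.inner_eq_zero (hR.proj _) (hR.proj _)
          (hR.excl _ _ (adj_cycleVertex (by omega) j)), map_zero])
      (by simp only [cycleVertex_self])
    rwa [sum_range_cycleVertex (fun i => ‖P i v‖ ^ 2)] at h
  rw [← ENNReal.ofReal_le_ofReal_iff (by positivity)]
  simp only [value, one_mul]
  rw [ENNReal.ofReal_sum_of_nonneg fun i _ => (hbeh i).1]
  simp only [← hprob]
  rw [← Summable.tsum_finsetSum fun _ _ => ENNReal.summable]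
  calc _ ≤ ∑' l, ENNReal.ofReal (n * kcbsProb n) *
        ENNReal.ofReal (‖ContinuousLinearMap.adjoint S (c l)‖ ^ 2) := by
        refine ENNReal.tsum_le_tsum fun l => ?_
        rw [← ENNReal.ofReal_sum_of_nonneg fun i _ => by positivity,
          ← ENNReal.ofReal_mul (by positivity)]
        exact ENNReal.ofReal_le_ofReal (hpure _)
    _ = _ := by
        rw [ENNReal.tsum_mul_left]
        have : ∑' l, ENNReal.ofReal (‖ContinuousLinearMap.adjoint S (c l)‖ ^ 2) = 1 := by
          simpa using htr
        rw [this, mul_one]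

/-- The behavior of a realization is a quantum behavior, with the pure state `|x 0⟩⟨x 0|`. -/
lemma behavior_mem_quantumBehaviors {n : ℕ} {G : SimpleGraph (Fin n)} {H : Type u}
    [NormedAddCommGroup H] [InnerProductSpace ℂ H] [CompleteSpace H] {x : Fin (n + 1) → H}
    (hx : IsRealization G x) : behavior x ∈ quantumBehaviors.{u} G := by
  have htr : ∀ v w : H, HasTrace (proj v ∘L proj w) ((‖inner ℂ v w‖ ^ 2 : ℝ) : ℂ) := by
    intro v w ι b
    have h := (b.hasSum_inner_mul_inner w v).mul_left (inner ℂ v w)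
    have e : ((‖inner ℂ v w‖ ^ 2 : ℝ) : ℂ) = inner ℂ v w * inner ℂ w v := by
      rw [← inner_conj_symm w v, Complex.mul_conj']
      push_cast; rfl
    rw [e]
    refine hasSum_of_forall_eq h fun k => ?_
    simp only [proj, ContinuousLinearMap.comp_apply, InnerProductSpace.rankOne_apply,
      inner_smul_right]
    ring
  refine ⟨⟨fun i => ⟨by unfold behavior; positivity, ?_⟩, fun i j hij => ?_⟩,
    H, inferInstance, inferInstance, inferInstance, proj (x 0), fun i => proj (x i.succ), ?_⟩
  · have := norm_inner_le_norm (𝕜 := ℂ) (x 0) (x i.succ)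
    rw [hx.norm_eq_one, hx.norm_eq_one, one_mul] at this
    exact pow_le_one₀ (norm_nonneg _) this
  · have hon : Orthonormal ℂ ![x i.succ, x j.succ] := by
      simp [orthonormal_vecCons_iff, hx.norm_eq_one, hx.excl i j hij]
    have h := hon.sum_inner_products_le (x := x 0) (s := Finset.univ)
    simpa [Fin.sum_univ_two, hx.norm_eq_one, behavior, norm_inner_symm (x 0)] using h
  · refine ⟨InnerProductSpace.isPositive_rankOne_self _, ?_, fun i => ?_, fun i => htr _ _,
      fun i j hij => ?_⟩
    · intro ι b
      have h := b.hasSum_inner_mul_inner (x 0) (x 0)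
      rw [inner_self_eq_ofReal, hx.norm_eq_one] at h
      simpa [proj] using h
    · exact InnerProductSpace.isStarProjection_rankOne_self (hx.norm_eq_one _)
    · simpa [hx.excl i j hij] using htr (x i.succ) (x j.succ)

end QuantumBound

/-! ### The optimal realization -/

section Optimal

variable {n : ℕ}

lemma isRealization_kcbsVectors (hodd : Odd n) (hn : 3 ≤ n) {θ : ℝ}
    (hθ : Real.cos θ ^ 2 = kcbsProb n) :
    IsRealization (SimpleGraph.cycleGraph n) (kcbsVectors n θ) := by
  have : NeZero n := ⟨by omega⟩
  have hedge : ∀ k < n, inner ℂ (kcbsVectors n θ (cycleVertex n k).succ)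
      (kcbsVectors n θ (cycleVertex n (k + 1)).succ) = 0 := by
    intro k hk
    rw [kcbsVectors_cycleVertex hodd θ hk.le, kcbsVectors_cycleVertex hodd θ hk]
    have h1 : altCos n k * altCos n (k + 1) + altSin n k * altSin n (k + 1) =
        -Real.cos (Real.pi / n) := by
      have h2 : (-1 : ℝ) ^ k * (-1) ^ k = 1 := by rw [← mul_pow]; simp
      have h3 : Real.cos ((k + 1 : ℕ) * (Real.pi / n) - k * (Real.pi / n)) =
          Real.cos (Real.pi / n) := by congr 1; push_cast; ring
      rw [Real.cos_sub] at h3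
      simp only [altCos, altSin, pow_succ]
      linear_combination (-(Real.cos ((k + 1 : ℕ) * (Real.pi / n)) * Real.cos (k * (Real.pi / n)))
        - Real.sin ((k + 1 : ℕ) * (Real.pi / n)) * Real.sin (k * (Real.pi / n))) * h2 - h3
    have h4 : Real.cos θ * Real.cos θ + Real.sin θ * altSin n (k + 1) * (Real.sin θ * altSin n k) +
        Real.sin θ * altCos n (k + 1) * (Real.sin θ * altCos n k) = 0 := by
      linear_combination Real.sin θ ^ 2 * h1 + (1 + Real.cos (Real.pi / n)) * hθ
        + kcbsProb_mul hn - Real.cos (Real.pi / n) * Real.sin_sq_add_cos_sq θ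
    rw [PiLp.inner_apply, Fin.sum_univ_three]
    simp only [Matrix.cons_val, RCLike.inner_apply, Complex.conj_ofReal]
    norm_cast
    linear_combination h4
  refine ⟨fun i => ?_, fun i j hij => ?_⟩
  · refine Fin.cases ?_ (fun i => ?_) i
    · simp [kcbsVectors, EuclideanSpace.norm_eq, Fin.sum_univ_three]
    · rw [kcbsVectors_succ, EuclideanSpace.norm_eq, Real.sqrt_eq_one, Fin.sum_univ_three]
      simp only [Matrix.cons_val, Complex.norm_real, Real.norm_eq_abs, sq_abs]
      linear_combination Real.sin_sq_add_cos_sq θ +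
        Real.sin θ ^ 2 * altCos_sq_add_altSin_sq n (i + 1)
  · obtain ⟨k, hk, ⟨rfl, rfl⟩ | ⟨rfl, rfl⟩⟩ := exists_cycleVertex_of_adj hij
    · exact hedge k hk
    · exact inner_eq_zero_symm.1 (hedge k hk)

lemma value_behavior_kcbsVectors [NeZero n] {θ : ℝ} (hθ : Real.cos θ ^ 2 = kcbsProb n) :
    value (fun _ => 1) (behavior (kcbsVectors n θ)) = n * kcbsProb n := by
  have h : ∀ i : Fin n, behavior (kcbsVectors n θ) i = kcbsProb n := by
    intro i
    have h0 : kcbsVectors n θ 0 = !₂[1, 0, 0] := by simp [kcbsVectors]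
    rw [behavior, kcbsVectors_succ, h0, PiLp.inner_apply, Fin.sum_univ_three]
    simp only [Matrix.cons_val, RCLike.inner_apply, map_one, map_zero, mul_one, mul_zero, add_zero]
    rw [← hθ, Complex.norm_real, Real.norm_eq_abs, sq_abs]
  simp [value, h]

/-- The quantum bound is attained, in every universe of Hilbert spaces. -/
lemma isGreatest_value_quantumBehaviors (hodd : Odd n) (hn : 3 ≤ n) {θ : ℝ}
    (hθ : Real.cos θ ^ 2 = kcbsProb n) :
    IsGreatest (value (fun _ => 1) '' quantumBehaviors.{u} (SimpleGraph.cycleGraph n))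
      (value (fun _ => 1) (behavior (kcbsVectors n θ))) := by
  have : NeZero n := ⟨by omega⟩
  constructor
  · -- The quantum behaviors use Hilbert spaces in `Type u`, so `ℂ³` has to be lifted.
    let e : EuclideanSpace ℂ (Fin 3) ≃ₗᵢ[ℂ] EuclideanSpace ℂ (ULift.{u} (Fin 3)) :=
      LinearIsometryEquiv.piLpCongrLeft 2 ℂ ℂ Equiv.ulift.symm
    have hreal := isRealization_kcbsVectors hodd hn hθ
    have hreal' : IsRealization (SimpleGraph.cycleGraph n) (fun i => e (kcbsVectors n θ i)) :=
      ⟨fun i => by rw [e.norm_map, hreal.norm_eq_one],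
        fun i j hij => by rw [e.inner_map_map, hreal.excl i j hij]⟩
    refine ⟨_, behavior_mem_quantumBehaviors hreal', ?_⟩
    simp only [value, behavior, e.inner_map_map]
  · rintro _ ⟨p, hp, rfl⟩
    rw [value_behavior_kcbsVectors hθ]
    exact value_le_of_mem_quantumBehaviors hodd hn hp

end Optimal

/-! ### The noncontextual bound -/

section Classical

variable {n : ℕ}

/-- Each deterministic assignment selects an independent set; counting edges, twice its size is at
most the odd number `n`. -/
lemma value_le_of_isDeterministic (hodd : Odd n) (hn : 2 ≤ n) {p : Fin n → ℝ}
    (hp : IsDeterministic (SimpleGraph.cycleGraph n) p) :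
    value (fun _ => 1) p ≤ ((n : ℝ) - 1) / 2 := by
  have : NeZero n := ⟨by omega⟩
  obtain ⟨k, hk⟩ := hodd
  obtain ⟨s, hs⟩ : ∃ s : ℕ, value (fun _ => 1) p = s := by
    have h : ∀ i, ∃ m : ℕ, p i = m := fun i => by
      rcases hp.1 i with h | h
      · exact ⟨0, by simp [h]⟩
      · exact ⟨1, by simp [h]⟩
    choose m hm using h
    exact ⟨∑ i, m i, by simp [value, hm]⟩
  have hedge : ∑ j ∈ Finset.range n, (p (cycleVertex n j) + p (cycleVertex n (j + 1))) ≤ n := by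
    calc _ ≤ ∑ j ∈ Finset.range n, (1 : ℝ) :=
          Finset.sum_le_sum fun j _ => hp.2 _ _ (adj_cycleVertex hn j)
      _ = n := by simp
  have h1 : ∑ j ∈ Finset.range n, p (cycleVertex n (j + 1)) = value (fun _ => 1) p := by
    rw [Finset.sum_range]; simp [value, cycleVertex_add_one]
  rw [Finset.sum_add_distrib, sum_range_cycleVertex, h1] at hedge
  have h2 : ∑ i, p i = value (fun _ => 1) p := by simp [value]
  rw [h2, hs] at hedge
  have h3 : s + s ≤ n := by exact_mod_cast hedge
  have h4 : (s : ℝ) ≤ k := by exact_mod_cast (by omega : s ≤ k)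
  rw [hs, hk]
  push_cast
  linarith

/-- The assignment that selects every second vertex. -/
def alternating (n : ℕ) (i : Fin n) : ℝ := if Odd (i : ℕ) then 1 else 0

lemma isDeterministic_alternating (hodd : Odd n) :
    IsDeterministic (SimpleGraph.cycleGraph n) (alternating n) := by
  have : NeZero n := ⟨hodd.pos.ne'⟩
  refine ⟨fun i => by unfold alternating; split_ifs <;> simp, fun i j hij => ?_⟩
  have key : ∀ i j : Fin n, ((j - i : Fin n) : ℕ) = 1 → alternating n i + alternating n j ≤ 1 := by
    intro i j h
    have hij : ¬(Odd (i : ℕ) ∧ Odd (j : ℕ)) := by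
      rintro ⟨hi, hj⟩
      rw [Fin.sub_def] at h
      have h' : (n - (i : ℕ) + j) % n = 1 := h
      obtain ⟨a, ha⟩ := hi
      obtain ⟨b, hb⟩ := hj
      obtain ⟨k, hk⟩ := hodd
      have hi2 := i.2
      have hj2 := j.2
      rcases Nat.lt_or_ge (n - (i : ℕ) + j) n with h1 | h1
      · rw [Nat.mod_eq_of_lt h1] at h'; omega
      · rw [Nat.mod_eq_sub_mod h1, Nat.mod_eq_of_lt (by omega)] at h'; omega
    unfold alternating
    split_ifs with h1 h2
    · exact absurd ⟨h1, h2⟩ hij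
    all_goals norm_num
  rw [SimpleGraph.cycleGraph_adj'] at hij
  rcases hij with h | h
  · rw [add_comm]; exact key j i h
  · exact key i j h

lemma value_alternating (hodd : Odd n) :
    value (fun _ => 1) (alternating n) = ((n : ℝ) - 1) / 2 := by
  obtain ⟨k, rfl⟩ := hodd
  have h : ∀ k : ℕ, ∑ i ∈ Finset.range (2 * k + 1), (if Odd i then (1 : ℝ) else 0) = k := by
    intro k
    induction k with
    | zero => simp
    | succ k ih =>
      rw [show 2 * (k + 1) + 1 = 2 * k + 1 + 1 + 1 by ring, Finset.sum_range_succ,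
        Finset.sum_range_succ, ih]
      have h1 : Odd (2 * k + 1) := ⟨k, rfl⟩
      have h2 : ¬ Odd (2 * k + 1 + 1) := by
        rw [Nat.not_odd_iff_even]; exact ⟨k + 1, by ring⟩
      simp [h1, h2]
  have h1 := h k
  rw [Finset.sum_range] at h1
  simp only [value, alternating, one_mul]
  rw [h1]
  push_cast; ring

lemma isNoncontextualityInequality_cycleGraph (hodd : Odd n) (hn : 2 ≤ n) :
    IsNoncontextualityInequality (SimpleGraph.cycleGraph n) (fun _ => 1) (((n : ℝ) - 1) / 2) := by
  refine ⟨fun _ => zero_le_one, ⟨alternating n, subset_convexHull ℝ _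
    (isDeterministic_alternating hodd), value_alternating hodd⟩, ?_⟩
  rintro _ ⟨p, hp, rfl⟩
  have hconv : Convex ℝ {p : Fin n → ℝ | value (fun _ => 1) p ≤ ((n : ℝ) - 1) / 2} :=
    convex_halfSpace_le (f := value (n := n) fun _ => 1)
      ⟨fun p q => by simp [value, Finset.sum_add_distrib], fun c p => by
        simp [value, Finset.mul_sum]⟩ _
  exact convexHull_min (fun p hp => value_le_of_isDeterministic hodd hn hp) hconv hp

end Classical

end Contextuality

theorem mainTheorem2 (n : ℕ) (hn : Odd n) (hn5 : 5 ≤ n) (θ : ℝ)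
    (hθ : Real.cos θ ^ 2 = Real.cos (Real.pi / n) / (1 + Real.cos (Real.pi / n))) :
    Contextuality.IsRobustSelfTest.{u} (1 / 2 : ℝ) (SimpleGraph.cycleGraph n) (fun _ => 1)
      (((n : ℝ) - 1) / 2) (Contextuality.kcbsVectors n θ) := by
  open Contextuality in
  have hn3 : 3 ≤ n := by omega
  have : NeZero n := ⟨by omega⟩
  have hθ' : Real.cos θ ^ 2 = kcbsProb n := hθ
  have hmax := isGreatest_value_quantumBehaviors.{u} hn hn3 hθ'
  have hsup : quantumSupremum.{u} (SimpleGraph.cycleGraph n) (fun _ => 1) = n * kcbsProb n :=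
    hmax.csSup_eq.trans (value_behavior_kcbsVectors hθ')
  obtain ⟨C, hC, hnear⟩ := exists_isometry_near.{u} hn hn5 hθ'
  refine ⟨⟨isNoncontextualityInequality_cycleGraph hn (by omega),
    isRealization_kcbsVectors hn hn3 hθ', hmax, ?_⟩, C, ?_⟩
  · intro H _ _ _ y hy hval
    obtain ⟨V, hV⟩ := hnear H y hy
    refine ⟨V, fun i => ?_⟩
    have h := hV i
    rw [hval, hsup, sub_self, Real.sqrt_zero, mul_zero] at h
    exact sub_eq_zero.1 (norm_le_zero_iff.1 h)
  · intro ε hε H _ _ _ y hy hval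
    obtain ⟨V, hV⟩ := hnear H y hy
    refine ⟨V, fun i => (hV i).trans ?_⟩
    rw [← Real.sqrt_eq_rpow]
    rw [hsup] at hval
    gcongr
    linarith
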